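/- Let $G=\widetilde{SL}_2$ be the universal covering group of $SL(2)=SL(2,\mathbb R)\cong SU(1,1)$. Its Lie algebra is identified with $\mathfrak{su}(1,1)$, and $e_1,e_2,e_3$ denotes the basis $$e_1=\tfrac12\begin{pmatrix}0&1\\1&0\end{pmatrix},\quad e_2=\tfrac12\begin{pmatrix}0&i\\-i&0\end{pmatrix},\quad e_3=\tfrac12\begin{pmatrix}i/2&0\\0&-i/2\end{pmatrix}.$$ Endow $G$ with the left invariant Riemannian metric $\langle\cdot,\cdot\rangle$ for which $e_1,e_2,e_3$ are orthonormal, with its Levi-Civita connection $\nabla$, and with the orientation for which $(e_1,e_2,e_3)$ is positive. Let $f:M\to G$ be a smooth immersion of a smooth surface $M$, let $N$ be a smooth unit normal field along $f$, and suppose that the mean curvature of $f$ with respect to $N$ (half of the trace of the second fundamental form $\langle\nabla_u\, df(v),N\rangle$ with respect to the induced metric) is equal to a constant $H\in\mathbb R$. For a local conformal parameter $z=x+iy$ on $M$ which is positive, i.e. such that $(f_x,f_y,N)$ is a positively oriented frame, put $\partial=\partial_z=\frac12(\partial_x-i\partial_y)$, expand $f^{-1}\partial f=\sum_{k=1}^3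 Z_k e_k$, where $f^{-1}$ denotes the left translation to the unit of $G$ (extended complex linearly), and let $A=\langle\nabla_{f_z}f_z,N\rangle$ be the coefficient of the Hopf differential ($\langle\cdot,\cdot\rangle$ and $\nabla$ being extended complex bilinearly). Then $$\widetilde A\,dz^2=\Bigl(A+\frac{5\,Z_3^2}{2(H-i)}\Bigr)dz^2$$ is a holomorphic quadratic differential on $M$: any two positive conformal parameters $z,w$ are related by a holomorphic change of parameter on their common domain, with $\widetilde A_z=\widetilde A_w\,(dw/dz)^2$ there, and in each positive conformal parameter $z$ the coefficient $\widetilde A$ is a holomorphic function of $z$. -/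

import Mathlib

open scoped Manifold ContDiff Matrix ComplexConjugate
open Complex (I)

noncomputable section

/-- The universal covering group of `SL(2)`. In the disc model `SL(2)` is realized as the group
`SU(1,1)` of the matrices with rows `(a, b)` and `(conj b, conj a)`, where `|a|² - |b|² = 1`. Such a
matrix is given by `b : ℂ` and the argument `t` of `a = √(1 + |b|²) exp (i t)`; on the universal
covering `t` is a real number, so that `(t, b) : ℝ × ℂ` is a global chart. -/
def SLTilde : Type := ℝ × ℂ

namespace SLTilde

instance : TopologicalSpace SLTilde := inferInstanceAs (TopologicalSpace (ℝ × ℂ))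
instance : ChartedSpace (ℝ × ℂ) SLTilde := inferInstanceAs (ChartedSpace (ℝ × ℂ) (ℝ × ℂ))
instance : IsManifold 𝓘(ℝ, ℝ × ℂ) ∞ SLTilde :=
  inferInstanceAs (IsManifold 𝓘(ℝ, ℝ × ℂ) ∞ (ℝ × ℂ))
instance : ContractibleSpace SLTilde := inferInstanceAs (ContractibleSpace (ℝ × ℂ))

/-- The entry `a` of the matrix below `g = (t, b)`. -/
def a (g : SLTilde) : ℂ := (√(1 + Complex.normSq g.2) : ℝ) * Complex.exp (g.1 * I)

/-- The entry `b` of the matrix below `g = (t, b)`. -/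
def b (g : SLTilde) : ℂ := g.2

lemma normSq_a (g : SLTilde) : Complex.normSq g.a = 1 + Complex.normSq g.b := by
  have h : 0 ≤ 1 + Complex.normSq g.2 := by have := Complex.normSq_nonneg g.2; linarith
  have h2 : Complex.normSq (Complex.exp (g.1 * I)) = 1 := by
    rw [Complex.normSq_eq_norm_sq, Complex.norm_exp_ofReal_mul_I]; norm_num
  simp only [a, b, Complex.normSq_mul, h2, Complex.normSq_ofReal, Real.mul_self_sqrt h, mul_one]

lemma a_ne_zero (g : SLTilde) : g.a ≠ 0 := by
  intro h
  have := normSq_a g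
  rw [h, Complex.normSq_zero] at this
  linarith [Complex.normSq_nonneg g.b]

/-- The product of the matrices below `g` and `h` has the upper left entry
`a(g) a(h) + b(g) conj (b(h)) = a(g) a(h) * corr g h`, and `corr g h` has positive real part. -/
def corr (g h : SLTilde) : ℂ := 1 + g.b * conj h.b / (g.a * h.a)

/-- The lift of the matrix product: the arguments of `a(g)`, `a(h)` and `corr g h` (the last one
in `(-π/2, π/2)`) add up. -/
instance : Mul SLTilde where
  mul g h := (g.1 + h.1 + (corr g h).arg, g.a * h.b + g.b * conj h.a)

instance : One SLTilde where
  one := ((0 : ℝ), (0 : ℂ))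

instance : Inv SLTilde where
  inv g := (-g.1, -g.2)

lemma mul_fst (g h : SLTilde) : (g * h).1 = g.1 + h.1 + (corr g h).arg := rfl
lemma b_mul (g h : SLTilde) : (g * h).b = g.a * h.b + g.b * conj h.a := rfl
lemma b_one : (1 : SLTilde).b = 0 := rfl
lemma b_inv (g : SLTilde) : (g⁻¹).b = -g.b := rfl
lemma a_one : (1 : SLTilde).a = 1 := by
  have h1 : (1 : SLTilde).1 = 0 := rfl
  have h2 : (1 : SLTilde).2 = 0 := rfl
  simp [a, h1, h2]
lemma a_inv (g : SLTilde) : (g⁻¹).a = conj g.a := by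
  have h1 : (g⁻¹).1 = -g.1 := rfl
  have h2 : (g⁻¹).2 = -g.2 := rfl
  simp only [a, h1, h2, Complex.normSq_neg, map_mul, Complex.conj_ofReal, ← Complex.exp_conj,
    Complex.conj_I]
  push_cast; ring_nf

lemma corr_re_pos (g h : SLTilde) : 0 < (corr g h).re := by
  have hn : ‖g.b * conj h.b / (g.a * h.a)‖ < 1 := by
    have key : ∀ k : SLTilde, ‖k.b‖ < ‖k.a‖ := fun k ↦ by
      have := normSq_a k
      rw [Complex.normSq_eq_norm_sq, Complex.normSq_eq_norm_sq] at this
      nlinarith [norm_nonneg k.a, norm_nonneg k.b]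
    have hg := key g
    have hh := key h
    have h1 := (norm_nonneg g.b).trans_lt hg
    have h2 := (norm_nonneg h.b).trans_lt hh
    rw [norm_div, norm_mul, norm_mul, RCLike.norm_conj, div_lt_one (mul_pos h1 h2)]
    exact mul_lt_mul'' hg hh (norm_nonneg _) (norm_nonneg _)
  have := (abs_lt.1 ((Complex.abs_re_le_norm _).trans_lt hn)).1
  simp only [corr, Complex.add_re, Complex.one_re]
  linarith

lemma abs_arg_corr_lt (g h : SLTilde) : |(corr g h).arg| < Real.pi / 2 :=
  Complex.abs_arg_lt_pi_div_two_iff.2 (Or.inl (corr_re_pos g h))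

lemma a_mul (g h : SLTilde) : (g * h).a = g.a * h.a + g.b * conj h.b := by
  have hw : g.a * h.a + g.b * conj h.b = g.a * h.a * corr g h := by
    have := a_ne_zero g
    have := a_ne_zero h
    unfold corr
    field_simp
  have hn : 1 + Complex.normSq (g * h).b = Complex.normSq (g.a * h.a + g.b * conj h.b) := by
    have h1 := normSq_a g
    have h2 := normSq_a h
    rw [b_mul]
    simp only [Complex.normSq_apply, Complex.add_re, Complex.add_im, Complex.mul_re,
      Complex.mul_im, Complex.conj_re, Complex.conj_im] at h1 h2 ⊢
    linear_combination (-(h.a.re * h.a.re + h.a.im * h.a.im) +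
      (h.b.re * h.b.re + h.b.im * h.b.im)) * h1 - h2
  have e : (g * h).a = (√(1 + Complex.normSq (g * h).b) : ℝ) *
      Complex.exp ((g.1 + h.1 + (corr g h).arg : ℝ) * I) := rfl
  have hc := Complex.norm_mul_exp_arg_mul_I (corr g h)
  rw [e, hn, hw, Complex.normSq_eq_norm_sq, Real.sqrt_sq (norm_nonneg _), norm_mul, norm_mul]
  have ha : ∀ k : SLTilde, (‖k.a‖ : ℂ) * Complex.exp (k.1 * I) = k.a := fun k ↦ by
    have : ‖k.a‖ = √(1 + Complex.normSq k.2) := by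
      rw [← Real.sqrt_sq (norm_nonneg k.a), ← Complex.normSq_eq_norm_sq, normSq_a]; rfl
    rw [this]; rfl
  calc _ = (‖g.a‖ * Complex.exp (g.1 * I)) * (‖h.a‖ * Complex.exp (h.1 * I)) *
        (‖corr g h‖ * Complex.exp ((corr g h).arg * I)) := by
          push_cast; rw [add_mul, add_mul, Complex.exp_add, Complex.exp_add]; ring
    _ = _ := by rw [hc, ha, ha]

lemma ext_of_abs_lt {g h : SLTilde} (ha : g.a = h.a) (hb : g.b = h.b)
    (ht : |g.1 - h.1| < 2 * Real.pi) : g = h := by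
  have hb' : g.2 = h.2 := hb
  have hs : ((√(1 + Complex.normSq h.2) : ℝ) : ℂ) ≠ 0 := fun h0 ↦ a_ne_zero h (by simp [a, h0])
  have he : Complex.exp (g.1 * I) = Complex.exp (h.1 * I) := by
    simp only [a, hb'] at ha
    exact mul_left_cancel₀ hs ha
  obtain ⟨n, hn⟩ := Complex.exp_eq_exp_iff_exists_int.1 he
  have hn' : g.1 - h.1 = n * (2 * Real.pi) := by
    have := congrArg Complex.im hn
    simp at this
    linarith
  have h0 : n = 0 := by
    rw [hn', abs_mul, abs_of_pos Real.two_pi_pos] at ht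
    have : |(n : ℝ)| < 1 := by
      by_contra! hc
      nlinarith [Real.two_pi_pos]
    rw [← Int.cast_abs] at this
    have h2 : |n| < 1 := by exact_mod_cast this
    exact Int.abs_lt_one_iff.1 h2
  refine Prod.ext ?_ hb'
  rw [h0] at hn'
  simpa [sub_eq_zero] using hn'

instance : Group SLTilde where
  mul_assoc g h k := by
    refine ext_of_abs_lt ?_ ?_ ?_
    · simp only [a_mul, b_mul, map_add, map_mul, Complex.conj_conj]; ring
    · simp only [a_mul, b_mul, map_add, map_mul, Complex.conj_conj]; ring
    · have h1 := abs_lt.1 (abs_arg_corr_lt (g * h) k)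
      have h2 := abs_lt.1 (abs_arg_corr_lt g h)
      have h3 := abs_lt.1 (abs_arg_corr_lt g (h * k))
      have h4 := abs_lt.1 (abs_arg_corr_lt h k)
      simp only [mul_fst]
      rw [abs_lt]
      constructor <;> linarith
  one_mul g := by
    refine Prod.ext ?_ ?_
    · rw [mul_fst]; simp [corr, b_one]; rfl
    · change (1 * g).b = g.b; simp [b_mul, b_one, a_one]
  mul_one g := by
    refine Prod.ext ?_ ?_
    · rw [mul_fst]; simp [corr, b_one]; rfl
    · change (g * 1).b = g.b; simp [b_mul, b_one, a_one]
  inv_mul_cancel g := by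
    refine ext_of_abs_lt ?_ ?_ ?_
    · rw [a_mul, a_one, a_inv, b_inv, neg_mul, Complex.mul_conj, ← Complex.normSq_eq_conj_mul_self,
        normSq_a]
      push_cast; ring
    · rw [b_mul, a_inv, b_inv, b_one]; ring
    · have h1 := abs_lt.1 (abs_arg_corr_lt g⁻¹ g)
      have h2 : (g⁻¹).1 = -g.1 := rfl
      have h3 : (1 : SLTilde).1 = 0 := rfl
      rw [mul_fst, h2, h3, abs_lt]
      constructor <;> linarith [Real.pi_pos]

lemma contDiff_a : ContDiff ℝ ∞ (fun g : ℝ × ℂ ↦ a g) := by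
  have h1 : ContDiff ℝ ∞ (fun g : ℝ × ℂ ↦ √(1 + ‖g.2‖ ^ 2)) :=
    (contDiff_const.add (contDiff_snd.norm_sq ℝ)).sqrt fun g ↦ by positivity
  have h2 : ContDiff ℝ ∞ (fun g : ℝ × ℂ ↦ Complex.exp (g.1 * I)) :=
    ((Complex.ofRealCLM.contDiff.comp contDiff_fst).mul contDiff_const).cexp
  have h3 := (Complex.ofRealCLM.contDiff.comp h1).mul h2
  have h4 : (fun g : ℝ × ℂ ↦ a g) = fun g : ℝ × ℂ ↦
      (√(1 + ‖g.2‖ ^ 2) : ℝ) * Complex.exp (g.1 * I) := by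
    funext g
    simp only [a, Complex.normSq_eq_norm_sq]
  rw [h4]
  exact h3

lemma contDiff_mul_aux : ContDiff ℝ ∞ (fun p : (ℝ × ℂ) × (ℝ × ℂ) ↦
    ((p.1.1 + p.2.1 + (corr p.1 p.2).arg, a p.1 * b p.2 + b p.1 * conj (a p.2)) : ℝ × ℂ)) := by
  have a1 : ContDiff ℝ ∞ (fun p : (ℝ × ℂ) × (ℝ × ℂ) ↦ a p.1) := contDiff_a.comp contDiff_fst
  have a2 : ContDiff ℝ ∞ (fun p : (ℝ × ℂ) × (ℝ × ℂ) ↦ a p.2) := contDiff_a.comp contDiff_snd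
  have b1 : ContDiff ℝ ∞ (fun p : (ℝ × ℂ) × (ℝ × ℂ) ↦ b p.1) :=
    contDiff_snd.comp contDiff_fst
  have b2 : ContDiff ℝ ∞ (fun p : (ℝ × ℂ) × (ℝ × ℂ) ↦ b p.2) :=
    contDiff_snd.comp contDiff_snd
  have hc : ContDiff ℝ ∞ (fun p : (ℝ × ℂ) × (ℝ × ℂ) ↦ corr p.1 p.2) := by
    unfold corr
    simp only [div_eq_mul_inv]
    exact contDiff_const.add ((b1.mul (Complex.conjCLE.contDiff.comp b2)).mul
      ((a1.mul a2).inv fun p ↦ mul_ne_zero (a_ne_zero p.1) (a_ne_zero p.2)))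
  have hl : ContDiff ℝ ∞ (fun p : (ℝ × ℂ) × (ℝ × ℂ) ↦ (corr p.1 p.2).arg) := by
    rw [contDiff_iff_contDiffAt]
    intro p
    have h1 : ContDiffAt ℝ ∞ Complex.log (corr p.1 p.2) :=
      (Complex.contDiffAt_log (Or.inl (corr_re_pos p.1 p.2))).restrict_scalars ℝ
    have h2 := Complex.imCLM.contDiff.contDiffAt.comp p (h1.comp p hc.contDiffAt)
    refine h2.congr_of_eventuallyEq (Filter.Eventually.of_forall fun q ↦ ?_)
    simp [Complex.log_im]
  exact ((((contDiff_fst.comp contDiff_fst).add (contDiff_fst.comp contDiff_snd)).add hl)).prodMk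
    ((a1.mul b2).add (b1.mul (Complex.conjCLE.contDiff.comp a2)))

/-- The universal covering group is a smooth Lie group. -/
instance : LieGroup 𝓘(ℝ, ℝ × ℂ) ∞ SLTilde where
  contMDiff_mul := by
    have := contDiff_mul_aux
    rw [← contMDiff_iff_contDiff, modelWithCornersSelf_prod, ← chartedSpaceSelf_prod] at this
    exact this
  contMDiff_inv := by
    have : ContDiff ℝ ∞ (fun p : ℝ × ℂ ↦ -p) := contDiff_neg
    exact this.contMDiff

/-- The real unimodular matrix below `g`, obtained from the matrix in `SU(1,1)` by the isomorphism
`SU(1,1) ≃ SL(2, ℝ)` (a Cayley transform). -/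
def realMatrix (g : SLTilde) : Matrix (Fin 2) (Fin 2) ℝ :=
  !![g.a.re + g.b.re, g.b.im - g.a.im; g.b.im + g.a.im, g.a.re - g.b.re]

lemma det_realMatrix (g : SLTilde) : g.realMatrix.det = 1 := by
  have := normSq_a g
  rw [Complex.normSq_apply, Complex.normSq_apply] at this
  rw [realMatrix, Matrix.det_fin_two_of]
  linarith

/-- The covering homomorphism onto `SL(2, ℝ)`. -/
def toSL : SLTilde →* Matrix.SpecialLinearGroup (Fin 2) ℝ where
  toFun g := ⟨g.realMatrix, g.det_realMatrix⟩
  map_one' := by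
    ext i j
    fin_cases i <;> fin_cases j <;> simp [realMatrix, a_one, b_one]
  map_mul' g h := by
    refine Subtype.ext ?_
    change (g * h).realMatrix = g.realMatrix * h.realMatrix
    ext i j
    fin_cases i <;> fin_cases j <;>
      simp [realMatrix, a_mul, b_mul, Matrix.mul_apply, Fin.sum_univ_two] <;> ring

lemma coe_toSL (g : SLTilde) : (toSL g).1 = g.realMatrix := rfl

lemma toSL_eq_one {g : SLTilde} (h : toSL g = 1) : g.a = 1 ∧ g.b = 0 := by
  have h' : g.realMatrix = 1 := by rw [← coe_toSL, h]; rfl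
  have h00 := congrFun (congrFun h' 0) 0
  have h01 := congrFun (congrFun h' 0) 1
  have h10 := congrFun (congrFun h' 1) 0
  have h11 := congrFun (congrFun h' 1) 1
  simp [realMatrix] at h00 h01 h10 h11
  constructor <;> apply Complex.ext <;> simp <;> linarith

lemma toSL_isOpenQuotientMap : IsOpenQuotientMap toSL := by
  have hpos : ∀ w : ℂ, 0 < 1 + Complex.normSq w := fun w ↦ by
    linarith [Complex.normSq_nonneg w]
  let aM : Matrix.SpecialLinearGroup (Fin 2) ℝ → ℂ :=
    fun m ↦ ⟨(m.1 0 0 + m.1 1 1) / 2, (m.1 1 0 - m.1 0 1) / 2⟩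
  let bM : Matrix.SpecialLinearGroup (Fin 2) ℝ → ℂ :=
    fun m ↦ ⟨(m.1 0 0 - m.1 1 1) / 2, (m.1 1 0 + m.1 0 1) / 2⟩
  have hab : ∀ m, Complex.normSq (aM m) = 1 + Complex.normSq (bM m) := fun m ↦ by
    have := m.2
    rw [Matrix.det_fin_two] at this
    simp only [aM, bM, Complex.normSq_apply]
    linarith
  have haM0 : ∀ m, aM m ≠ 0 := fun m h ↦ by
    have := hab m
    rw [h, Complex.normSq_zero] at this
    linarith [hpos (bM m)]
  have hentry : ∀ i j, Continuous fun m : Matrix.SpecialLinearGroup (Fin 2) ℝ ↦ m.1 i j :=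
    fun i j ↦ (continuous_apply j).comp ((continuous_apply i).comp continuous_subtype_val)
  have haMc : Continuous aM := by
    have : aM = fun m ↦ Complex.equivRealProdCLM.symm
      ((m.1 0 0 + m.1 1 1) / 2, (m.1 1 0 - m.1 0 1) / 2) := by
      funext m; simp [aM, Complex.ext_iff]
    rw [this]
    exact Complex.equivRealProdCLM.symm.continuous.comp
      ((((hentry 0 0).add (hentry 1 1)).div_const 2).prodMk
        (((hentry 1 0).sub (hentry 0 1)).div_const 2))
  have hbMc : Continuous bM := by
    have : bM = fun m ↦ Complex.equivRealProdCLM.symm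
      ((m.1 0 0 - m.1 1 1) / 2, (m.1 1 0 + m.1 0 1) / 2) := by
      funext m; simp [bM, Complex.ext_iff]
    rw [this]
    exact Complex.equivRealProdCLM.symm.continuous.comp
      ((((hentry 0 0).sub (hentry 1 1)).div_const 2).prodMk
        (((hentry 1 0).add (hentry 0 1)).div_const 2))
  have hsq : ∀ w : ℂ, (√(1 + Complex.normSq w)) * (√(1 + Complex.normSq w)) =
    1 + Complex.normSq w := fun w ↦ Real.mul_self_sqrt (hpos w).le
  have hn : ∀ m, ‖aM m‖ = √(1 + Complex.normSq (bM m)) := fun m ↦ by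
    rw [← hab, Complex.normSq_eq_norm_sq, Real.sqrt_sq (norm_nonneg _)]
  have hs0 : ∀ w : ℂ, ((√(1 + Complex.normSq w) : ℝ) : ℂ) ≠ 0 := fun w ↦ by
    exact_mod_cast (Real.sqrt_pos.2 (hpos w)).ne'
  let E : Circle × ℂ → Matrix.SpecialLinearGroup (Fin 2) ℝ := fun p ↦
        ⟨!![√(1 + Complex.normSq p.2) * (p.1 : ℂ).re + p.2.re,
            p.2.im - √(1 + Complex.normSq p.2) * (p.1 : ℂ).im;
            p.2.im + √(1 + Complex.normSq p.2) * (p.1 : ℂ).im,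
            √(1 + Complex.normSq p.2) * (p.1 : ℂ).re - p.2.re], by
          have h1 := hsq p.2
          have h2 := Circle.normSq_coe p.1
          rw [Complex.normSq_apply] at h1 h2
          rw [Matrix.det_fin_two_of, Complex.normSq_apply]
          linear_combination h1 +
            √(1 + (p.2.re * p.2.re + p.2.im * p.2.im)) ^ 2 * h2⟩
  let e : Circle × ℂ ≃ₜ Matrix.SpecialLinearGroup (Fin 2) ℝ :=
    { toFun := E
      invFun := fun m ↦ (⟨aM m / (‖aM m‖ : ℝ), by
        simp [Submonoid.unitSphere, haM0 m]⟩, bM m)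
      left_inv := fun p ↦ by
        have ha : aM (E p) = √(1 + Complex.normSq p.2) * (p.1 : ℂ) := by
          apply Complex.ext <;> simp [aM, E]
        have hb : bM (E p) = p.2 := by
          apply Complex.ext <;> simp [bM, E]
        refine Prod.ext (Subtype.ext ?_) hb
        change aM (E p) / (‖aM (E p)‖ : ℝ) = p.1
        rw [hn, hb, ha]
        exact mul_div_cancel_left₀ _ (hs0 p.2)
      right_inv := fun m ↦ by
        have h0 := hs0 (bM m)
        have hre : √(1 + Complex.normSq (bM m)) * (aM m / (‖aM m‖ : ℝ)) = aM m := by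
          rw [hn]; field_simp
        have h1 := congrArg Complex.re hre
        have h2 := congrArg Complex.im hre
        rw [Complex.re_ofReal_mul] at h1
        rw [Complex.im_ofReal_mul] at h2
        apply Subtype.ext
        change !![√(1 + Complex.normSq (bM m)) * (aM m / (‖aM m‖ : ℝ)).re + (bM m).re,
            (bM m).im - √(1 + Complex.normSq (bM m)) * (aM m / (‖aM m‖ : ℝ)).im;
            (bM m).im + √(1 + Complex.normSq (bM m)) * (aM m / (‖aM m‖ : ℝ)).im,
            √(1 + Complex.normSq (bM m)) * (aM m / (‖aM m‖ : ℝ)).re - (bM m).re] = m.1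
        rw [h1, h2]
        ext i j
        fin_cases i <;> fin_cases j <;> simp [aM, bM] <;> ring
      continuous_toFun := by
        refine Continuous.subtype_mk (continuous_matrix fun i j ↦ ?_) _
        have c1 : Continuous fun p : Circle × ℂ ↦ √(1 + Complex.normSq p.2) :=
          (continuous_const.add (Complex.continuous_normSq.comp continuous_snd)).sqrt
        have c2 : Continuous fun p : Circle × ℂ ↦ (p.1 : ℂ).re :=
          Complex.continuous_re.comp (continuous_subtype_val.comp continuous_fst)
        have c3 : Continuous fun p : Circle × ℂ ↦ (p.1 : ℂ).im :=
          Complex.continuous_im.comp (continuous_subtype_val.comp continuous_fst)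
        have c4 : Continuous fun p : Circle × ℂ ↦ p.2.re :=
          Complex.continuous_re.comp continuous_snd
        have c5 : Continuous fun p : Circle × ℂ ↦ p.2.im :=
          Complex.continuous_im.comp continuous_snd
        fin_cases i <;> fin_cases j
        · exact (c1.mul c2).add c4
        · exact c5.sub (c1.mul c3)
        · exact c5.add (c1.mul c3)
        · exact (c1.mul c2).sub c4
      continuous_invFun := by
        refine Continuous.prodMk (Continuous.subtype_mk (haMc.div ?_ fun m ↦ ?_) _) hbMc
        · exact Complex.continuous_ofReal.comp (continuous_norm.comp haMc)
        · simpa using haM0 m }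
  have h1 : IsOpenQuotientMap (Prod.map Circle.exp id : ℝ × ℂ → Circle × ℂ) :=
    IsOpenQuotientMap.prodMap Circle.isAddQuotientCoveringMap_exp.isOpenQuotientMap .id
  have h2 := e.isOpenQuotientMap.comp h1
  have h3 : (e ∘ (Prod.map Circle.exp id : ℝ × ℂ → Circle × ℂ)) = (toSL : ℝ × ℂ → _) := by
    funext g
    apply Subtype.ext
    have h4 : ∀ w : ℝ × ℂ, a w = (√(1 + Complex.normSq w.2) : ℝ) * (Circle.exp w.1 : ℂ) :=
      fun w ↦ by rw [Circle.coe_exp]; rfl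
    change _ = realMatrix g
    simp only [realMatrix, h4, Complex.re_ofReal_mul, Complex.im_ofReal_mul]
    rfl
  rw [h3] at h2
  exact h2

/-- `SLTilde` is contractible (hence simply connected), and it covers `SL(2, ℝ)`. -/
lemma toSL_isCoveringMap : IsCoveringMap toSL := by
  have : IsTopologicalGroup SLTilde := topologicalGroup_of_lieGroup 𝓘(ℝ, ℝ × ℂ) ∞
  have hk : IsDiscrete (toSL.ker : Set SLTilde) := by
    rw [isDiscrete_iff_forall_mem_exists_isOpen]
    intro g hg
    refine ⟨{h | |h.1 - g.1| < 2 * Real.pi}, ?_, ?_⟩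
    · have : Continuous fun h : ℝ × ℂ ↦ |h.1 - g.1| := (continuous_fst.sub continuous_const).abs
      exact isOpen_lt this continuous_const
    · have hg' := toSL_eq_one hg
      ext h
      constructor
      · rintro ⟨h1, h2⟩
        have h2' := toSL_eq_one h2
        exact ext_of_abs_lt (h2'.1.trans hg'.1.symm) (h2'.2.trans hg'.2.symm) h1
      · rintro rfl
        exact ⟨by simp [Real.pi_pos], hg⟩
  exact (toSL_isOpenQuotientMap.isQuotientMap.isQuotientCoveringMap_of_isDiscrete_ker_monoidHom
    hk).isCoveringMap


/-- The matrix in `SU(1,1)` below `g`. -/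
def complexMatrix (g : SLTilde) : Matrix (Fin 2) (Fin 2) ℂ := !![g.a, g.b; conj g.b, conj g.a]

lemma complexMatrix_mul (g h : SLTilde) :
    (g * h).complexMatrix = g.complexMatrix * h.complexMatrix := by
  ext i j
  fin_cases i <;> fin_cases j <;>
    simp [complexMatrix, a_mul, b_mul, Matrix.mul_apply, Fin.sum_univ_two] <;> ring

/-- The generators `f₁, f₂, f₃` of the Lie algebra of `SU(1,1)`, the velocities at the unit of the
hyperbolic translations along the real and the imaginary axis of the disc and of the rotations about
its center. They satisfy `[f₁, f₂] = -4 f₃`, `[f₁, f₃] = -f₂`, `[f₂, f₃] = f₁`. -/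
def generator : Fin 3 → Matrix (Fin 2) (Fin 2) ℂ :=
  ![!![0, 1; 1, 0], !![0, I; -I, 0], !![I / 2, 0; 0, -I / 2]]

/-- The Lie algebra, that is the tangent space at the unit. -/
abbrev LieAlg : Type := GroupLieAlgebra 𝓘(ℝ, ℝ × ℂ) SLTilde

/-- An element of the Lie algebra in the chart `(t, b)`. -/
def toPair (v : LieAlg) : ℝ × ℂ := v

/-- The coordinates of an element of the Lie algebra in the basis `frame`. -/
def frameEquiv : LieAlg ≃ₗ[ℝ] (Fin 3 → ℝ) where
  toFun v := ![2 * (toPair v).2.re, 2 * (toPair v).2.im, 4 * (toPair v).1]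
  invFun c := ((c 2 / 4, ⟨c 0 / 2, c 1 / 2⟩) : ℝ × ℂ)
  map_add' v w := by
    have h1 : (toPair (v + w)).1 = (toPair v).1 + (toPair w).1 := rfl
    have h2 : (toPair (v + w)).2 = (toPair v).2 + (toPair w).2 := rfl
    ext i
    fin_cases i <;> simp [h1, h2] <;> ring
  map_smul' r v := by
    have h1 : (toPair (r • v)).1 = r * (toPair v).1 := rfl
    have h2 : (toPair (r • v)).2 = (r : ℂ) * (toPair v).2 := (Complex.real_smul).symm ▸ rfl
    ext i
    fin_cases i <;> simp [h1, h2] <;> ring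
  left_inv v := by
    change ((4 * (toPair v).1 / 4, ⟨2 * (toPair v).2.re / 2, 2 * (toPair v).2.im / 2⟩) : ℝ × ℂ)
      = toPair v
    refine Prod.ext ?_ (Complex.ext ?_ ?_) <;> simp
  right_inv c := by
    ext i
    fin_cases i <;> simp [toPair] <;> ring

/-- The basis `e₁, e₂, e₃` (indexed by `0, 1, 2`) of the Lie algebra that corresponds to
`f₁ / 2, f₂ / 2, f₃ / 2`, see `hasDerivAt_complexMatrix`. It is declared to be orthonormal
(`⟨f_j, f_k⟩ = 4 δ_jk`) and positively oriented. -/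
def frame : Module.Basis (Fin 3) ℝ LieAlg := .ofEquivFun frameEquiv

lemma frame_repr_apply (v : LieAlg) (k : Fin 3) :
    frame.repr v k = ![2 * (toPair v).2.re, 2 * (toPair v).2.im, 4 * (toPair v).1] k := by
  rw [frame, Module.Basis.ofEquivFun_repr_apply]
  rfl

lemma toPair_frame (j : Fin 3) :
    toPair (frame j) = (![(0, 1 / 2), (0, I / 2), (1 / 4, 0)] : Fin 3 → ℝ × ℂ) j := by
  have h : ∀ k, ![2 * (toPair (frame j)).2.re, 2 * (toPair (frame j)).2.im,
      4 * (toPair (frame j)).1] k = if j = k then 1 else 0 := fun k ↦ by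
    rw [← frame_repr_apply, Module.Basis.repr_self_apply]
  have h0 := h 0
  have h1 := h 1
  have h2 := h 2
  refine Prod.ext ?_ (Complex.ext ?_ ?_) <;> fin_cases j <;> simp at h0 h1 h2 ⊢ <;> linarith

lemma hasDerivAt_a (v : ℝ × ℂ) :
    HasDerivAt (fun t : ℝ ↦ a ((t • v : ℝ × ℂ))) (v.1 * I) 0 := by
  have h1 : HasDerivAt (fun t : ℝ ↦ √(1 + t ^ 2 * Complex.normSq v.2)) 0 0 := by
    have := ((((hasDerivAt_id (0 : ℝ)).pow 2).mul_const (Complex.normSq v.2)).const_add 1).sqrt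
      (by simp)
    simpa using this
  have h2 : HasDerivAt (fun t : ℝ ↦ Complex.exp (((t * v.1 : ℝ) : ℂ) * I)) (v.1 * I) 0 := by
    have := (((hasDerivAt_id (0 : ℝ)).mul_const v.1).ofReal_comp.mul_const I).cexp
    simpa using this
  have h3 := h1.ofReal_comp.mul h2
  have h4 : (fun t : ℝ ↦ a ((t • v : ℝ × ℂ))) = fun t : ℝ ↦
      ((√(1 + t ^ 2 * Complex.normSq v.2) : ℝ) : ℂ) * Complex.exp (((t * v.1 : ℝ) : ℂ) * I) := by
    funext t
    simp [a, pow_two]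
  rw [h4]
  refine h3.congr_deriv ?_
  simp

lemma hasDerivAt_b (v : ℝ × ℂ) :
    HasDerivAt (fun t : ℝ ↦ b ((t • v : ℝ × ℂ))) v.2 0 := by
  have := (hasDerivAt_id (0 : ℝ)).smul_const v.2
  simpa [b] using this

/-- Under the differential of the projection to matrices, `e_j` is mapped to `f_j / 2`. -/
lemma hasDerivAt_complexMatrix (j : Fin 3) (r s : Fin 2) :
    HasDerivAt (fun t : ℝ ↦ complexMatrix ((t • toPair (frame j)) : ℝ × ℂ) r s)
      (((1 / 2 : ℂ) • generator j) r s) 0 := by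
  have ha := hasDerivAt_a (toPair (frame j))
  have hb := hasDerivAt_b (toPair (frame j))
  have ha' : HasDerivAt (fun t : ℝ ↦ conj (a (t • toPair (frame j) : ℝ × ℂ))) _ 0 := ha.star
  have hb' : HasDerivAt (fun t : ℝ ↦ conj (b (t • toPair (frame j) : ℝ × ℂ))) _ 0 := hb.star
  rw [toPair_frame] at *
  fin_cases r <;> fin_cases s
  · refine ha.congr_deriv ?_
    fin_cases j <;> simp [generator]; ring
  · refine hb.congr_deriv ?_
    fin_cases j <;> simp [generator]; ring
  · refine hb'.congr_deriv ?_
    fin_cases j <;> simp [generator]; ring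
  · refine ha'.congr_deriv ?_
    fin_cases j <;> simp [generator]; ring

lemma mulInvariantVectorField_apply (v : LieAlg) (g : SLTilde) :
    mulInvariantVectorField v g =
      (((toPair v).1 + (g.b * conj (toPair v).2 / g.a).im,
        g.a * (toPair v).2 - I * (toPair v).1 * g.b) : ℝ × ℂ) := by
  let F : ℝ × ℂ → ℝ × ℂ := fun h ↦
    (g.1 + h.1 + (corr g h).arg, a g * b h + b g * conj (a h))
  have hd : DifferentiableAt ℝ F 0 := by
    have h1 := contDiff_mul_aux.differentiable (by simp)
    have h2 := h1.comp ((differentiable_const (toPair g)).prodMk differentiable_id)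
    exact h2 0
  have e1 : mulInvariantVectorField v g = fderiv ℝ F 0 (toPair v) := by
    rw [mulInvariantVectorField]
    exact congrArg (fun L : (ℝ × ℂ) →L[ℝ] (ℝ × ℂ) ↦ L (toPair v)) mfderiv_eq_fderiv
  rw [e1]
  have hl : HasDerivAt (fun t : ℝ ↦ t • toPair v) (toPair v) 0 := by
    simpa using (hasDerivAt_id (0 : ℝ)).smul_const (toPair v)
  have hF := HasFDerivAt.comp_hasDerivAt_of_eq (0 : ℝ) hd.hasFDerivAt hl (by simp)
  refine hF.unique ?_
  have ha := hasDerivAt_a (toPair v)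
  have hb := hasDerivAt_b (toPair v)
  have ha' : HasDerivAt (fun t : ℝ ↦ conj (a (t • toPair v : ℝ × ℂ))) _ 0 := ha.star
  have hb' : HasDerivAt (fun t : ℝ ↦ conj (b (t • toPair v : ℝ × ℂ))) _ 0 := hb.star
  have z1 : a (((0 : ℝ) • toPair v : ℝ × ℂ)) = 1 := by rw [zero_smul]; exact a_one
  have z2 : b (((0 : ℝ) • toPair v : ℝ × ℂ)) = 0 := by rw [zero_smul]; exact b_one
  have hc : HasDerivAt (fun t : ℝ ↦ corr g (t • toPair v : ℝ × ℂ))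
      (g.b * conj (toPair v).2 / g.a) 0 := by
    have := ((hb'.const_mul g.b).div (ha.const_mul g.a)
      (mul_ne_zero (a_ne_zero g) (a_ne_zero _))).const_add 1
    refine this.congr_deriv ?_
    have := a_ne_zero g
    simp only [z1, z2]
    simp
    field_simp
  have hlog := hc.clog_real (by
    have := corr_re_pos g ((0 : ℝ) • toPair v : ℝ × ℂ)
    exact Or.inl this)
  have hcz : corr g ((0 : ℝ) • toPair v : ℝ × ℂ) = 1 := by
    simp only [corr, z1, z2]; simp
  rw [hcz, div_one] at hlog
  have harg := Complex.imCLM.hasFDerivAt.comp_hasDerivAt (0 : ℝ) hlog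
  have ht : HasDerivAt (fun t : ℝ ↦ g.1 + t * (toPair v).1) (toPair v).1 0 := by
    simpa using ((hasDerivAt_id (0 : ℝ)).mul_const (toPair v).1).const_add g.1
  have h2 := (ha'.const_mul g.b)
  have h3 := (hb.const_mul g.a).add h2
  refine ((ht.add harg).prodMk h3).congr_deriv ?_ |>.congr_of_eventuallyEq ?_
  · refine Prod.ext ?_ ?_
    · simp
    · simp; ring
  · refine Filter.Eventually.of_forall fun t ↦ ?_
    refine Prod.ext ?_ rfl
    simp only [Function.comp]
    change g.1 + t * (toPair v).1 + (corr g _).arg = _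
    simp [Complex.log_im]

lemma mlieBracket_modelSpace (V W : ∀ x : ℝ × ℂ, TangentSpace 𝓘(ℝ, ℝ × ℂ) x) (x : ℝ × ℂ) :
    VectorField.mlieBracket 𝓘(ℝ, ℝ × ℂ) (M := ℝ × ℂ) V W x = VectorField.lieBracket ℝ V W x := by
  have h1 := congrFun (VectorField.mlieBracketWithin_univ (I := 𝓘(ℝ, ℝ × ℂ)) (V := V) (W := W)) x
  have h2 := congrFun
    (VectorField.mlieBracketWithin_eq_lieBracketWithin (V := V) (W := W) (s := Set.univ)) x
  have h3 := congrFun (VectorField.lieBracketWithin_univ (𝕜 := ℝ) (V := V) (W := W)) x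
  exact h1.symm.trans (h2.trans h3)

lemma lie_apply (v w : LieAlg) :
    ⁅v, w⁆ = ((2 * ((toPair v).2 * conj (toPair w).2).im,
      2 * I * ((toPair v).1 * (toPair w).2 -
        (toPair w).1 * (toPair v).2)) : ℝ × ℂ) := by
  let V : LieAlg → ℝ × ℂ → ℝ × ℂ := fun v g ↦
    ((toPair v).1 + (b g * conj (toPair v).2 / a g).im,
        a g * (toPair v).2 - I * (toPair v).1 * b g)
  have hV : ∀ v, mulInvariantVectorField v = V v := fun v ↦
    funext (mulInvariantVectorField_apply v)
  have hVd : ∀ v, DifferentiableAt ℝ (V v) 0 := fun v ↦ by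
    have a1 : DifferentiableAt ℝ (fun g : ℝ × ℂ ↦ a g) 0 := contDiff_a.differentiable (by simp) 0
    have b1 : DifferentiableAt ℝ (fun g : ℝ × ℂ ↦ b g) 0 := differentiable_snd 0
    have h1 := (Complex.imCLM.differentiableAt.comp (0 : ℝ × ℂ)
      (((b1.mul_const (conj (toPair v).2)).mul (a1.inv (a_ne_zero _))))).const_add (toPair v).1
    have h2 := (a1.mul_const (toPair v).2).sub (b1.const_mul (I * (toPair v).1))
    exact h1.prodMk h2
  have hV0 : ∀ v, V v 0 = toPair v := fun v ↦ by
    have z1 : a (0 : ℝ × ℂ) = 1 := a_one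
    have z2 : b (0 : ℝ × ℂ) = 0 := b_one
    simp [V, z1, z2]
  have hD : ∀ v w, fderiv ℝ (V w) 0 (toPair v) =
      (((toPair v).2 * conj (toPair w).2).im,
        I * (toPair v).1 * (toPair w).2 - I * (toPair w).1 * (toPair v).2) := fun v w ↦ by
    have hl : HasDerivAt (fun t : ℝ ↦ t • toPair v) (toPair v) 0 := by
      simpa using (hasDerivAt_id (0 : ℝ)).smul_const (toPair v)
    have hF := HasFDerivAt.comp_hasDerivAt_of_eq (0 : ℝ) (hVd w).hasFDerivAt hl (by simp)
    refine hF.unique ?_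
    have ha := hasDerivAt_a (toPair v)
    have hb := hasDerivAt_b (toPair v)
    have z1 : a (((0 : ℝ) • toPair v : ℝ × ℂ)) = 1 := by rw [zero_smul]; exact a_one
    have z2 : b (((0 : ℝ) • toPair v : ℝ × ℂ)) = 0 := by rw [zero_smul]; exact b_one
    have h1 := (Complex.imCLM.hasFDerivAt.comp_hasDerivAt (0 : ℝ)
      ((hb.mul_const (conj (toPair w).2)).div ha (a_ne_zero _))).const_add (toPair w).1
    have h2 := (ha.mul_const (toPair w).2).sub (hb.const_mul (I * (toPair w).1))
    refine (h1.prodMk h2).congr_deriv ?_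
    refine Prod.ext ?_ ?_
    · rw [z1, z2]; simp
    · simp only [mul_comm I]
  have hb : ⁅v, w⁆ = VectorField.lieBracket ℝ (V v) (V w) 0 := by
    rw [GroupLieAlgebra.bracket_def, hV, hV]
    exact mlieBracket_modelSpace (V v) (V w) 0
  rw [hb, VectorField.lieBracket, hV0, hV0, hD, hD]
  refine Prod.ext ?_ ?_
  · simp; ring
  · simp; ring

lemma toPair_lie (v w : LieAlg) :
    toPair ⁅v, w⁆ = (2 * ((toPair v).2 * conj (toPair w).2).im,
      2 * I * ((toPair v).1 * (toPair w).2 - (toPair w).1 * (toPair v).2)) := lie_apply v w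

/-- The commutation relations of the basis. -/
lemma lie_frame : ⁅frame 0, frame 1⁆ = (-2 : ℝ) • frame 2 ∧
    ⁅frame 0, frame 2⁆ = (-(1 / 2) : ℝ) • frame 1 ∧ ⁅frame 1, frame 2⁆ = (1 / 2 : ℝ) • frame 0 := by
  have h0 : toPair (frame 0) = (0, 1 / 2) := toPair_frame 0
  have h1 : toPair (frame 1) = (0, I / 2) := toPair_frame 1
  have h2 : toPair (frame 2) = (1 / 4, 0) := toPair_frame 2
  refine ⟨?_, ?_, ?_⟩ <;>
  · apply frame.repr.injective
    ext k
    rw [frame_repr_apply, toPair_lie, map_smul, Finsupp.smul_apply, Module.Basis.repr_self_apply]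
    simp only [h0, h1, h2]
    fin_cases k <;> (simp [map_ofNat]; try norm_num)

/-- The structure constants `⟨[e_i, e_j], e_k⟩`. -/
def structConst (i j k : Fin 3) : ℝ := frame.repr ⁅frame i, frame j⁆ k

/-- The coefficients of the Levi-Civita connection of the left invariant metric in the left invariant
orthonormal frame, by the Koszul formula: `∇_{e_k} e_j = ∑ i, connCoeff k j i • e_i`. -/
def connCoeff (k j i : Fin 3) : ℝ :=
  (structConst k j i + structConst i k j + structConst i j k) / 2

lemma structConst_antisymm (i j k : Fin 3) : structConst i j k = -structConst j i k := by
  simp only [structConst, frame_repr_apply, toPair_lie]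
  fin_cases k <;> simp <;> ring

/-- The connection is torsion-free. -/
lemma connCoeff_torsion (k j i : Fin 3) :
    connCoeff k j i - connCoeff j k i = structConst k j i := by
  simp only [connCoeff]
  rw [structConst_antisymm j k i]
  ring

/-- The connection is compatible with the metric. -/
lemma connCoeff_metric (k j i : Fin 3) : connCoeff k j i = -connCoeff k i j := by
  simp only [connCoeff]
  rw [structConst_antisymm k j i, structConst_antisymm i k j, structConst_antisymm i j k]
  ring

/-- The coordinates of `∇_u v` for left invariant vector fields `u` and `v`, given by their
coordinates in the frame; for `R = ℂ` this is the complex bilinear extension. -/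
def nabla {R : Type*} [CommRing R] [Algebra ℝ R] (u v : Fin 3 → R) (i : Fin 3) : R :=
  ∑ k, ∑ j, connCoeff k j i • (u k * v j)

/-- The coordinates in the frame `e₁, e₂, e₃` of the left translate `g⁻¹ v` to the unit of a vector `v`
tangent at `g`. -/
def coords (g : SLTilde) (v : TangentSpace 𝓘(ℝ, ℝ × ℂ) g) : Fin 3 → ℝ :=
  frame.repr (mfderiv 𝓘(ℝ, ℝ × ℂ) 𝓘(ℝ, ℝ × ℂ) (fun h ↦ g⁻¹ * h) g v)

/-- The left invariant Riemannian metric for which `e₁, e₂, e₃` are orthonormal. -/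
def metric (g : SLTilde) (v w : TangentSpace 𝓘(ℝ, ℝ × ℂ) g) : ℝ := coords g v ⬝ᵥ coords g w

/-- The left invariant frame is orthonormal. -/
lemma metric_frame (g : SLTilde) (j k : Fin 3) :
    metric g (mulInvariantVectorField (frame j) g) (mulInvariantVectorField (frame k) g) =
      if j = k then 1 else 0 := by
  have h : ∀ v : LieAlg, coords g (mulInvariantVectorField v g) = frame.repr v := fun v ↦ by
    have e1 : ∀ x, x = g * 1 →
        (mfderiv 𝓘(ℝ, ℝ × ℂ) 𝓘(ℝ, ℝ × ℂ) (fun h : SLTilde ↦ g⁻¹ * h) x : (ℝ × ℂ) →L[ℝ] (ℝ × ℂ)) =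
          mfderiv 𝓘(ℝ, ℝ × ℂ) 𝓘(ℝ, ℝ × ℂ) (fun h : SLTilde ↦ g⁻¹ * h) (g * 1) := by
      rintro _ rfl
      rfl
    have e2 := mfderiv_comp (I := 𝓘(ℝ, ℝ × ℂ)) (I' := 𝓘(ℝ, ℝ × ℂ)) (I'' := 𝓘(ℝ, ℝ × ℂ))
      (1 : SLTilde) (g := fun h : SLTilde ↦ g⁻¹ * h) (f := fun h : SLTilde ↦ g * h)
      ((contMDiff_mul_left (n := ∞)).mdifferentiableAt (by simp))
      ((contMDiff_mul_left (n := ∞)).mdifferentiableAt (by simp))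
    have e3 : (fun h : SLTilde ↦ g⁻¹ * h) ∘ (fun h : SLTilde ↦ g * h) = id := by
      funext h
      simp
    rw [e3, mfderiv_id] at e2
    have e4 : ∀ L : (ℝ × ℂ) →L[ℝ] (ℝ × ℂ), L =
        mfderiv 𝓘(ℝ, ℝ × ℂ) 𝓘(ℝ, ℝ × ℂ) (fun h : SLTilde ↦ g⁻¹ * h) (g * 1) →
        L (mulInvariantVectorField v g) = v := by
      rintro _ rfl
      exact (congrArg (fun L : (ℝ × ℂ) →L[ℝ] (ℝ × ℂ) ↦ L v) e2).symm
    exact congrArg (fun x : LieAlg ↦ (frame.repr x : Fin 3 → ℝ)) (e4 _ (e1 g (mul_one g).symm))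
  rw [metric, h, h]
  simp only [dotProduct, Module.Basis.repr_self_apply]
  fin_cases j <;> fin_cases k <;> simp

variable {M : Type*} [TopologicalSpace M] [ChartedSpace ℂ M]

/-- A smooth immersed surface. The surface `M` is a smooth real two-dimensional manifold. -/
structure IsSmoothImmersion (f : M → SLTilde) : Prop where
  smooth : ContMDiff 𝓘(ℝ, ℂ) 𝓘(ℝ, ℝ × ℂ) ∞ f
  injective_mfderiv : ∀ p, Function.Injective (mfderiv 𝓘(ℝ, ℂ) 𝓘(ℝ, ℝ × ℂ) f p)

/-- The coordinates of `f⁻¹ df(u)`. -/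
def diffCoords (f : M → SLTilde) (p : M) (u : TangentSpace 𝓘(ℝ, ℂ) p) : Fin 3 → ℝ :=
  coords (f p) (mfderiv 𝓘(ℝ, ℂ) 𝓘(ℝ, ℝ × ℂ) f p u)

/-- The coordinates of `f⁻¹ N`, for a vector field `N` along `f`. -/
def normalCoords (f : M → SLTilde) (N : ∀ p, TangentSpace 𝓘(ℝ, ℝ × ℂ) (f p)) (p : M) :
    Fin 3 → ℝ := coords (f p) (N p)

/-- `N` is a smooth unit normal field along the surface. -/
structure IsUnitNormalField (f : M → SLTilde) (N : ∀ p, TangentSpace 𝓘(ℝ, ℝ × ℂ) (f p)) :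
    Prop where
  smooth : ContMDiff 𝓘(ℝ, ℂ) 𝓘(ℝ, Fin 3 → ℝ) ∞ (normalCoords f N)
  orthogonal : ∀ p (u : TangentSpace 𝓘(ℝ, ℂ) p),
    metric (f p) (N p) (mfderiv 𝓘(ℝ, ℂ) 𝓘(ℝ, ℝ × ℂ) f p u) = 0
  unit : ∀ p, metric (f p) (N p) (N p) = 1

/-- The first fundamental form. -/
def inducedMetric (f : M → SLTilde) (p : M) (u v : TangentSpace 𝓘(ℝ, ℂ) p) : ℝ :=
  metric (f p) (mfderiv 𝓘(ℝ, ℂ) 𝓘(ℝ, ℝ × ℂ) f p u) (mfderiv 𝓘(ℝ, ℂ) 𝓘(ℝ, ℝ × ℂ) f p v)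

/-- The coordinates of `f⁻¹ (∇_u N)`, the Levi-Civita derivative of the vector field `N` along `f`. -/
def covDerivNormal (f : M → SLTilde) (N : ∀ p, TangentSpace 𝓘(ℝ, ℝ × ℂ) (f p)) (p : M)
    (u : TangentSpace 𝓘(ℝ, ℂ) p) : Fin 3 → ℝ :=
  fun i ↦ (mfderiv 𝓘(ℝ, ℂ) 𝓘(ℝ, Fin 3 → ℝ) (normalCoords f N) p u : Fin 3 → ℝ) i +
    nabla (diffCoords f p u) (normalCoords f N p) i

/-- The second fundamental form `⟨∇_u df(v), N⟩ = -⟨∇_u N, df(v)⟩`. -/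
def secondFundamentalForm (f : M → SLTilde) (N : ∀ p, TangentSpace 𝓘(ℝ, ℝ × ℂ) (f p)) (p : M)
    (u v : TangentSpace 𝓘(ℝ, ℂ) p) : ℝ :=
  -(covDerivNormal f N p u ⬝ᵥ diffCoords f p v)

/-- `H` is the mean curvature at `p` with respect to `N`: half of the trace of the second fundamental
form with respect to the first one. -/
def HasMeanCurvatureAt (f : M → SLTilde) (N : ∀ p, TangentSpace 𝓘(ℝ, ℝ × ℂ) (f p)) (H : ℝ)
    (p : M) : Prop :=
  ∀ u v : TangentSpace 𝓘(ℝ, ℂ) p,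
    inducedMetric f p u u = 1 → inducedMetric f p v v = 1 → inducedMetric f p u v = 0 →
      H = (secondFundamentalForm f N p u u + secondFundamentalForm f N p v v) / 2

/-- The coordinates of `f⁻¹ ∂f/∂x` in the local parameter `φ = x + iy`. -/
def partialX (f : M → SLTilde) (φ : OpenPartialHomeomorph M ℂ) (w : ℂ) : Fin 3 → ℝ :=
  diffCoords (f ∘ φ.symm) w (1 : ℂ)

/-- The coordinates of `f⁻¹ ∂f/∂y` in the local parameter `φ = x + iy`. -/
def partialY (f : M → SLTilde) (φ : OpenPartialHomeomorph M ℂ) (w : ℂ) : Fin 3 → ℝ :=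
  diffCoords (f ∘ φ.symm) w I

/-- `φ = x + iy` is a smooth conformal parameter on an open subset of the surface, and it is positive:
`(∂f/∂x, ∂f/∂y, N)` is a positively oriented frame, that is `N` is the normal given by the parameter. -/
structure IsConformalParameter (f : M → SLTilde) (N : ∀ p, TangentSpace 𝓘(ℝ, ℝ × ℂ) (f p))
    (φ : OpenPartialHomeomorph M ℂ) : Prop where
  mem_maximalAtlas : φ ∈ IsManifold.maximalAtlas 𝓘(ℝ, ℂ) ∞ M
  conformal : ∀ w ∈ φ.target,
    partialX f φ w ⬝ᵥ partialX f φ w = partialY f φ w ⬝ᵥ partialY f φ w ∧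
    partialX f φ w ⬝ᵥ partialY f φ w = 0
  positive : ∀ w ∈ φ.target,
    0 < (Matrix.of ![partialX f φ w, partialY f φ w, normalCoords f N (φ.symm w)]).det

/-- The operator `∂ = (∂/∂x - i ∂/∂y) / 2`. -/
def wirtinger (h : ℂ → ℂ) (w : ℂ) : ℂ := (fderiv ℝ h w 1 - I * fderiv ℝ h w I) / 2

/-- The coefficients in `f⁻¹ ∂f = ∑ k, Z_k e_k`. The third one is `Z f φ w 2`. -/
def Z (f : M → SLTilde) (φ : OpenPartialHomeomorph M ℂ) (w : ℂ) (k : Fin 3) : ℂ :=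
  ((partialX f φ w k : ℂ) - I * (partialY f φ w k : ℂ)) / 2

/-- The coefficient `A = ⟨∇_{f_z} f_z, N⟩` of the Hopf differential. -/
def hopfCoeff (f : M → SLTilde) (N : ∀ p, TangentSpace 𝓘(ℝ, ℝ × ℂ) (f p))
    (φ : OpenPartialHomeomorph M ℂ) (w : ℂ) : ℂ :=
  ∑ i, (wirtinger (fun ζ ↦ Z f φ ζ i) w + nabla (Z f φ w) (Z f φ w) i) *
    (normalCoords f N (φ.symm w) i : ℂ)

/-- The coefficient `A + 5 Z₃² / (2 (H - i))`. -/
def abreschCoeff (f : M → SLTilde) (N : ∀ p, TangentSpace 𝓘(ℝ, ℝ × ℂ) (f p)) (H : ℝ)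
    (φ : OpenPartialHomeomorph M ℂ) (w : ℂ) : ℂ :=
  hopfCoeff f N φ w + 5 / (2 * ((H : ℂ) - I)) * Z f φ w 2 ^ 2

/-- The functions `q φ`, for the local parameters `φ` in `P`, are the coefficients of a holomorphic
quadratic differential `q dz²`: changes of parameters are holomorphic, the coefficients are related
by `q_z = q_w (dw/dz)²`, and each of them is a holomorphic function of the parameter. -/
structure IsHolomorphicQuadraticDifferential (P : Set (OpenPartialHomeomorph M ℂ))
    (q : OpenPartialHomeomorph M ℂ → ℂ → ℂ) : Prop where
  transform : ∀ φ ∈ P, ∀ ψ ∈ P, ∀ p ∈ φ.source ∩ ψ.source, ∃ c : ℂ,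
    HasDerivAt (ψ ∘ φ.symm) c (φ p) ∧ q φ (φ p) = q ψ (ψ p) * c ^ 2
  holomorphic : ∀ φ ∈ P, DifferentiableOn ℂ (q φ) φ.target

end SLTilde

end

noncomputable section

/-! ### Left translation and the connection in matrix entries. -/

namespace SLTilde

/-! In the left invariant frame the Levi-Civita connection has constant coefficients, `∇_u v = -u ×
v + (5/2) u₃ (e₃ × v)`. The first summand is rotationally symmetric; the second is the anisotropy of
the metric, and it is the source of the 5 in the statement.

Write `Z` for `f⁻¹ f_z`, `Zb` for its conjugate, `n` for the coordinates of the normal, and `l = ⟨Z,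
Zb⟩`. A positive conformal parameter makes `Z` and `Zb` isotropic, with `n × Z = iZ` and `l ≠ 0`, so
that `Z, Zb, n` is a complex frame. The Maurer-Cartan equation (`diffCoords_symm`) says that `∇_∂̄
f_z = ∇_∂ f_z̄`. By isotropy this vector is normal, and by the definition of the mean curvature it
equals `H l n`. In the third coordinate the connection term contributes `i l n₃`, hence `∂̄ Z₃ = (H
- i) l n₃` and `∂̄ (Z₃²) = 2 (H - i) l Z₃ n₃`.

The Hopf coefficient is `A = -⟨∇_∂ n, Z⟩`, while `⟨∇_∂̄ n, Z⟩ = -H l`. Comparing `∂̄` of the former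
with `∂` of the latter, the mixed second derivative of `n` drops out. As `H` is constant, what
remains is the Codazzi equation `∂̄ A = -5 l Z₃ n₃`. The multiple `5 / (2 (H - i))` of `Z₃²` cancels
exactly this; the denominator does not vanish because `H` is real. The pointwise algebra is
`holomorphicity_identity`, and `IsCMCFrame.differentiableOn` supplies the derivatives.

For the change of parameters, two conformal parameters inducing the same orientation satisfy the
Cauchy-Riemann equations (`cauchyRiemann_of_conformal`). Then `Z` and `∂ n` both scale by `c =
dw/dz`, so `A` and `Z₃²` scale by `c²`. -/

lemma differentiable_a : Differentiable ℝ (fun g : ℝ × ℂ ↦ a g) :=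
  contDiff_a.differentiable (by simp)

lemma fderiv_a_zero (v : ℝ × ℂ) : fderiv ℝ (fun g : ℝ × ℂ ↦ a g) 0 v = v.1 * I := by
  have hl : HasDerivAt (fun t : ℝ ↦ t • v) v 0 := by
    simpa using (hasDerivAt_id (0 : ℝ)).smul_const v
  exact (HasFDerivAt.comp_hasDerivAt_of_eq (0 : ℝ) (differentiable_a 0).hasFDerivAt hl
    (by simp)).unique (hasDerivAt_a v)

/-- The left translate to the unit of a vector tangent at `g`, in the chart `(t, b)`. -/
def toUnit (g : SLTilde) (v : ℝ × ℂ) : ℝ × ℂ :=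
  mfderiv 𝓘(ℝ, ℝ × ℂ) 𝓘(ℝ, ℝ × ℂ) (fun h ↦ g⁻¹ * h) g v

lemma coords_eq (g : SLTilde) (v : ℝ × ℂ) :
    coords g v = ![2 * (toUnit g v).2.re, 2 * (toUnit g v).2.im, 4 * (toUnit g v).1] :=
  funext fun k ↦ frame_repr_apply (toUnit g v) k

/-- These are the entries of the matrix `g⁻¹ dg`. Left translation by `g⁻¹` carries `g` to the unit,
where the differential of `a` is `i dt` and that of `b` is the second chart coordinate; the entries
of `g⁻¹ h` are given by `a_mul` and `b_mul`. -/
lemma toUnit_apply (g : ℝ × ℂ) (v : ℝ × ℂ) :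
    ((toUnit g v).1 * I : ℂ) =
      conj (a g) * fderiv ℝ (fun h : ℝ × ℂ ↦ a h) g v - b g * conj v.2 ∧
    (toUnit g v).2 =
      conj (a g) * v.2 - b g * conj (fderiv ℝ (fun h : ℝ × ℂ ↦ a h) g v) := by
  let k : SLTilde := Inv.inv (α := SLTilde) g
  let k' : ℝ × ℂ := k
  let L : ℝ × ℂ → ℝ × ℂ := fun h : SLTilde ↦ k * h
  have hLd : DifferentiableAt ℝ L g := by
    have h1 := contDiff_mul_aux.differentiable (by simp)
    have h2 := h1.comp ((differentiable_const k').prodMk differentiable_id)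
    exact h2 g
  have e1 : toUnit g v = fderiv ℝ L g v :=
    congrArg (fun T : (ℝ × ℂ) →L[ℝ] (ℝ × ℂ) ↦ T v) mfderiv_eq_fderiv
  have hLg : L g = 0 := inv_mul_cancel (G := SLTilde) g
  have hA : HasFDerivAt (fun h : ℝ × ℂ ↦ a h) (fderiv ℝ (fun h : ℝ × ℂ ↦ a h) g) g :=
    (differentiable_a g).hasFDerivAt
  have hB : HasFDerivAt (fun h : ℝ × ℂ ↦ h.2) (ContinuousLinearMap.snd ℝ ℝ ℂ) g :=
    hasFDerivAt_snd
  have hA' := Complex.conjCLE.hasFDerivAt.comp g hA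
  have hB' := Complex.conjCLE.hasFDerivAt.comp g hB
  have hA0 : HasFDerivAt (fun h : ℝ × ℂ ↦ a h) (fderiv ℝ (fun h : ℝ × ℂ ↦ a h) 0) (L g) := by
    rw [hLg]
    exact (differentiable_a 0).hasFDerivAt
  have h1 : HasFDerivAt (fun h : ℝ × ℂ ↦ a (L h)) _ g := hA0.comp g hLd.hasFDerivAt
  have h2 : HasFDerivAt (fun h : ℝ × ℂ ↦ (L h).2) _ g := hasFDerivAt_snd.comp g hLd.hasFDerivAt
  have ka : k.a = conj (a g) := a_inv g
  have kb : k.b = -b g := b_inv g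
  have e2 : (fun h : ℝ × ℂ ↦ a (L h)) = fun h : ℝ × ℂ ↦ conj (a g) * a h - b g * conj h.2 := by
    funext h
    refine (a_mul k h).trans ?_
    rw [ka, kb, neg_mul, ← sub_eq_add_neg]
    rfl
  have e3 : (fun h : ℝ × ℂ ↦ (L h).2) =
      fun h : ℝ × ℂ ↦ conj (a g) * h.2 - b g * conj (a h) := by
    funext h
    refine (b_mul k h).trans ?_
    rw [ka, kb, neg_mul, ← sub_eq_add_neg]
    rfl
  rw [e2] at h1
  rw [e3] at h2
  have u1 := congrArg (fun T : (ℝ × ℂ) →L[ℝ] ℂ ↦ T v)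
    (h1.unique ((hA.const_mul (conj (a g))).sub (hB'.const_mul (b g))))
  have u2 := congrArg (fun T : (ℝ × ℂ) →L[ℝ] ℂ ↦ T v)
    (h2.unique ((hB.const_mul (conj (a g))).sub (hA'.const_mul (b g))))
  rw [e1]
  constructor
  · rw [← fderiv_a_zero (fderiv ℝ L g v)]
    simpa [hLg] using u1
  · simpa using u2

/-- `frameCoords a b da db` are the coordinates in the frame of `g⁻¹ dg`, if `da`, `db` are the
derivatives of the entries `a`, `b` of the matrix below `g`. -/
def frameCoords (a b da db : ℂ) : Fin 3 → ℝ :=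
  ![2 * (conj a * db - b * conj da).re, 2 * (conj a * db - b * conj da).im,
    4 * (conj a * da - b * conj db).im]

lemma coords_eq_frameCoords (g v : ℝ × ℂ) :
    coords g v = frameCoords (a g) (b g) (fderiv ℝ (fun h : ℝ × ℂ ↦ a h) g v) v.2 := by
  have h := toUnit_apply g v
  have h1 := congrArg Complex.im h.1
  refine (coords_eq g v).trans ?_
  rw [frameCoords, ← h.2, ← h1]
  simp

/-- The diagonal entry of `g⁻¹ dg` is purely imaginary, because this matrix lies in the Lie algebra.
-/
lemma re_fderiv_a (g v : ℝ × ℂ) :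
    (conj (a g) * fderiv ℝ (fun h : ℝ × ℂ ↦ a h) g v - b g * conj v.2).re = 0 := by
  rw [← (toUnit_apply g v).1]
  simp

/-- Each bracket of two basis vectors is a multiple of the third, so only coefficients with three
distinct indices survive in the Koszul formula. -/
lemma connCoeff_table :
    connCoeff = ![![![0, 0, 0], ![0, 0, -1], ![0, 1, 0]], ![![0, 0, 1], ![0, 0, 0], ![-1, 0, 0]],
      ![![0, 3 / 2, 0], ![-(3 / 2), 0, 0], ![0, 0, 0]]] := by
  have h0 : toPair (frame 0) = (0, 1 / 2) := toPair_frame 0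
  have h1 : toPair (frame 1) = (0, I / 2) := toPair_frame 1
  have h2 : toPair (frame 2) = (1 / 4, 0) := toPair_frame 2
  funext k j i
  simp only [connCoeff, structConst, frame_repr_apply, toPair_lie]
  fin_cases k <;> fin_cases j <;> fin_cases i <;> simp [h0, h1, h2, map_ofNat] <;> norm_num

/-- The connection in coordinates, as the cross product with `(-u₀, -u₁, 3/2 u₂)`. -/
lemma nabla_eq {R : Type*} [CommRing R] [Algebra ℝ R] (u v : Fin 3 → R) :
    nabla u v = ![-(u 1 * v 2) - (3 / 2 : ℝ) • (u 2 * v 1),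
      u 0 * v 2 + (3 / 2 : ℝ) • (u 2 * v 0), u 1 * v 0 - u 0 * v 1] := by
  funext i
  simp only [nabla, connCoeff_table, Fin.sum_univ_three]
  fin_cases i <;> simp <;> ring

/-! ### The Maurer-Cartan equation. -/

section MaurerCartan

variable {F : ℂ → ℝ × ℂ} {s : Set ℂ} {w : ℂ}

lemma diffCoords_eq (hF : DifferentiableAt ℝ F w) (u : ℂ) :
    diffCoords F w u = frameCoords (a (F w)) (b (F w)) (fderiv ℝ (fun ζ ↦ a (F ζ)) w u)
      (fderiv ℝ (fun ζ ↦ b (F ζ)) w u) := by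
  have e1 : diffCoords F w u = coords (F w) (fderiv ℝ F w u) :=
    congrArg (fun T : ℂ →L[ℝ] (ℝ × ℂ) ↦ coords (F w) (T u)) mfderiv_eq_fderiv
  have e2 : fderiv ℝ (fun ζ ↦ a (F ζ)) w = (fderiv ℝ (fun h : ℝ × ℂ ↦ a h) (F w)).comp
      (fderiv ℝ F w) := fderiv_comp w (differentiable_a (F w)) hF
  have e3 : fderiv ℝ (fun ζ ↦ b (F ζ)) w = (ContinuousLinearMap.snd ℝ ℝ ℂ).comp (fderiv ℝ F w) :=
    (hasFDerivAt_snd.comp w hF.hasFDerivAt).fderiv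
  rw [e1, e2, e3]
  exact coords_eq_frameCoords (F w) (fderiv ℝ F w u)

lemma re_diffCoords (hF : DifferentiableAt ℝ F w) (u : ℂ) :
    (conj (a (F w)) * fderiv ℝ (fun ζ ↦ a (F ζ)) w u -
      b (F w) * conj (fderiv ℝ (fun ζ ↦ b (F ζ)) w u)).re = 0 := by
  have e2 : fderiv ℝ (fun ζ ↦ a (F ζ)) w = (fderiv ℝ (fun h : ℝ × ℂ ↦ a h) (F w)).comp
      (fderiv ℝ F w) := fderiv_comp w (differentiable_a (F w)) hF
  have e3 : fderiv ℝ (fun ζ ↦ b (F ζ)) w = (ContinuousLinearMap.snd ℝ ℝ ℂ).comp (fderiv ℝ F w) :=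
    (hasFDerivAt_snd.comp w hF.hasFDerivAt).fderiv
  rw [e2, e3]
  exact re_fderiv_a (F w) (fderiv ℝ F w u)

lemma contDiffOn_fderiv_apply {E : Type*} [NormedAddCommGroup E] [NormedSpace ℝ E] {h : ℂ → E}
    (hs : IsOpen s) (hh : ContDiffOn ℝ ∞ h s) (u : ℂ) :
    ContDiffOn ℝ ∞ (fun ζ ↦ fderiv ℝ h ζ u) s :=
  (hh.fderiv_of_isOpen hs (by simp)).clm_apply contDiffOn_const

lemma contDiffOn_entries (hF : ContDiffOn ℝ ∞ F s) :
    ContDiffOn ℝ ∞ (fun ζ ↦ a (F ζ)) s ∧ ContDiffOn ℝ ∞ (fun ζ ↦ b (F ζ)) s :=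
  ⟨contDiff_a.comp_contDiffOn hF, contDiff_snd.comp_contDiffOn hF⟩

lemma contDiffOn_diffCoords (hs : IsOpen s) (hF : ContDiffOn ℝ ∞ F s) (u : ℂ) :
    ContDiffOn ℝ ∞ (fun ζ ↦ diffCoords F ζ u) s := by
  obtain ⟨ha, hb⟩ := contDiffOn_entries hF
  have hda := contDiffOn_fderiv_apply hs ha u
  have hdb := contDiffOn_fderiv_apply hs hb u
  have hc : ∀ {h : ℂ → ℂ}, ContDiffOn ℝ ∞ h s → ContDiffOn ℝ ∞ (fun ζ ↦ conj (h ζ)) s :=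
    fun h ↦ Complex.conjCLE.contDiff.comp_contDiffOn h
  have hP := ((hc ha).mul hda).sub (hb.mul (hc hdb))
  have hQ := ((hc ha).mul hdb).sub (hb.mul (hc hda))
  have h0 : ContDiffOn ℝ ∞ (fun ζ ↦ frameCoords (a (F ζ)) (b (F ζ))
      (fderiv ℝ (fun ζ ↦ a (F ζ)) ζ u) (fderiv ℝ (fun ζ ↦ b (F ζ)) ζ u)) s := by
    rw [contDiffOn_pi]
    intro k
    fin_cases k
    · exact contDiffOn_const.mul (Complex.reCLM.contDiff.comp_contDiffOn hQ)
    · exact contDiffOn_const.mul (Complex.imCLM.contDiff.comp_contDiffOn hQ)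
    · exact contDiffOn_const.mul (Complex.imCLM.contDiff.comp_contDiffOn hP)
  refine h0.congr fun ζ hζ ↦ diffCoords_eq ?_ u
  exact (hF.differentiableOn (by simp)).differentiableAt (hs.mem_nhds hζ)

lemma fderiv_fderiv_apply {h : ℂ → ℂ} (hs : IsOpen s) (hh : ContDiffOn ℝ ∞ h s) (hw : w ∈ s)
    (u v : ℂ) : fderiv ℝ (fun ζ ↦ fderiv ℝ h ζ u) w v = fderiv ℝ (fun ζ ↦ fderiv ℝ h ζ v) w u := by
  have hd : DifferentiableAt ℝ (fderiv ℝ h) w :=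
    ((hh.fderiv_of_isOpen hs (m := ∞) (by simp)).differentiableOn (by simp)).differentiableAt
      (hs.mem_nhds hw)
  have e : ∀ u v, fderiv ℝ (fun ζ ↦ fderiv ℝ h ζ u) w v = fderiv ℝ (fderiv ℝ h) w v u :=
    fun u v ↦ by rw [fderiv_clm_apply hd (differentiableAt_const u)]; simp
  rw [e, e]
  have := (hh.contDiffAt (hs.mem_nhds hw)).isSymmSndFDerivAt
    (by simpa using ENat.LEInfty.out)
  exact this.eq v u

/-- The bracketed vectors are the coordinates of `∂_u (g⁻¹ g_v)` and `∂_v (g⁻¹ g_u)`, with `p`, `q`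
the mixed second derivatives of the entries, common to both sides. The difference of the two vectors
is minus the bracket of `g⁻¹ g_u` and `g⁻¹ g_v`, which the torsion-free connection compensates. -/
lemma structure_equation {α β αu βu αv βv : ℂ} (hn : α * conj α - β * conj β = 1)
    (ru : (conj α * αu - β * conj βu).re = 0) (rv : (conj α * αv - β * conj βv).re = 0)
    (p q : ℂ) :
    ![2 * (conj αu * βv + conj α * q - βu * conj αv - β * conj p).re,
      2 * (conj αu * βv + conj α * q - βu * conj αv - β * conj p).im,
      4 * (conj αu * αv + conj α * p - βu * conj βv - β * conj q).im] +
        nabla (frameCoords α β αu βu) (frameCoords α β αv βv) =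
    ![2 * (conj αv * βu + conj α * q - βv * conj αu - β * conj p).re,
      2 * (conj αv * βu + conj α * q - βv * conj αu - β * conj p).im,
      4 * (conj αv * αu + conj α * p - βv * conj βu - β * conj q).im] +
        nabla (frameCoords α β αv βv) (frameCoords α β αu βu) := by
  -- Insert `g g⁻¹`, of determinant one by `hn`, into `(g⁻¹)_u g_v`. The off-diagonal entry in `hQ`
  -- is already antisymmetric in `u` and `v`; the diagonal one has to be antisymmetrized.
  have hP : (conj αu * αv - βu * conj βv) - (conj αv * αu - βv * conj βu) =
      (conj (conj α * αu - β * conj βu) * (conj α * αv - β * conj βv) -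
        (conj α * βu - β * conj αu) * conj (conj α * βv - β * conj αv)) -
      (conj (conj α * αv - β * conj βv) * (conj α * αu - β * conj βu) -
        (conj α * βv - β * conj αv) * conj (conj α * βu - β * conj αu)) := by
    simp only [map_sub, map_mul, Complex.conj_conj]
    linear_combination -((conj αu * αv - βu * conj βv) - (conj αv * αu - βv * conj βu)) * hn
  have hQ : (conj αu * βv - βu * conj αv) =
      (conj (conj α * αu - β * conj βu) * (conj α * βv - β * conj αv) -
        (conj α * βu - β * conj αu) * conj (conj α * αv - β * conj βv)) := by
    simp only [map_sub, map_mul, Complex.conj_conj]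
    linear_combination -(conj αu * βv - βu * conj αv) * hn
  simp only [frameCoords, nabla_eq]
  generalize conj α * αu - β * conj βu = Pu at *
  generalize conj α * αv - β * conj βv = Pv at *
  generalize conj α * βu - β * conj αu = Qu at *
  generalize conj α * βv - β * conj αv = Qv at *
  have hQr := congrArg Complex.re hQ
  have hQi := congrArg Complex.im hQ
  have hPi := congrArg Complex.im hP
  simp [ru, rv] at hQr hQi hPi
  funext k
  fin_cases k <;> simp
  · linear_combination 4 * hQr
  · linear_combination 4 * hQi
  · linear_combination 4 * hPi

/-- The Maurer-Cartan equation, in terms of the torsion-free connection. -/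
lemma diffCoords_symm (hs : IsOpen s) (hF : ContDiffOn ℝ ∞ F s) (hw : w ∈ s) (u v : ℂ) :
    fderiv ℝ (fun ζ ↦ diffCoords F ζ v) w u + nabla (diffCoords F w u) (diffCoords F w v) =
      fderiv ℝ (fun ζ ↦ diffCoords F ζ u) w v + nabla (diffCoords F w v) (diffCoords F w u) := by
  obtain ⟨ha, hb⟩ := contDiffOn_entries hF
  have hd : ∀ {E : Type} [NormedAddCommGroup E] [NormedSpace ℝ E] {h : ℂ → E},
      ContDiffOn ℝ ∞ h s → DifferentiableAt ℝ h w := fun h ↦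
    (h.differentiableOn (by simp)).differentiableAt (hs.mem_nhds hw)
  have hFw := hd hF
  set α : ℂ → ℂ := fun ζ ↦ a (F ζ) with hα
  set β : ℂ → ℂ := fun ζ ↦ b (F ζ) with hβ
  have hc : ∀ {h : ℂ → ℂ} {L : ℂ →L[ℝ] ℂ}, HasFDerivAt h L w →
      HasFDerivAt (fun ζ ↦ conj (h ζ)) ((Complex.conjCLE : ℂ →L[ℝ] ℂ).comp L) w :=
    fun h ↦ Complex.conjCLE.hasFDerivAt.comp w h
  have key : ∀ u v, fderiv ℝ (fun ζ ↦ diffCoords F ζ v) w u =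
      ![2 * (conj (fderiv ℝ α w u) * fderiv ℝ β w v +
          conj (α w) * fderiv ℝ (fun ζ ↦ fderiv ℝ β ζ v) w u - fderiv ℝ β w u * conj (fderiv ℝ α w v) -
          β w * conj (fderiv ℝ (fun ζ ↦ fderiv ℝ α ζ v) w u)).re,
        2 * (conj (fderiv ℝ α w u) * fderiv ℝ β w v +
          conj (α w) * fderiv ℝ (fun ζ ↦ fderiv ℝ β ζ v) w u - fderiv ℝ β w u * conj (fderiv ℝ α w v) -
          β w * conj (fderiv ℝ (fun ζ ↦ fderiv ℝ α ζ v) w u)).im,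
        4 * (conj (fderiv ℝ α w u) * fderiv ℝ α w v +
          conj (α w) * fderiv ℝ (fun ζ ↦ fderiv ℝ α ζ v) w u - fderiv ℝ β w u * conj (fderiv ℝ β w v) -
          β w * conj (fderiv ℝ (fun ζ ↦ fderiv ℝ β ζ v) w u)).im] := by
    intro u v
    have ee : (fun ζ ↦ diffCoords F ζ v) =ᶠ[nhds w] fun ζ ↦
        frameCoords (α ζ) (β ζ) (fderiv ℝ α ζ v) (fderiv ℝ β ζ v) := by
      filter_upwards [hs.mem_nhds hw] with ζ hζ
      exact diffCoords_eq ((hF.differentiableOn (by simp)).differentiableAt (hs.mem_nhds hζ)) v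
    have d1 := (hd ha).hasFDerivAt
    have d2 := (hd hb).hasFDerivAt
    have d3 := (hd (contDiffOn_fderiv_apply hs ha v)).hasFDerivAt
    have d4 := (hd (contDiffOn_fderiv_apply hs hb v)).hasFDerivAt
    have dP := ((hc d1).mul d3).sub (d2.mul (hc d4))
    have dQ := ((hc d1).mul d4).sub (d2.mul (hc d3))
    have h0 := (Complex.reCLM.hasFDerivAt.comp w dQ).const_mul (2 : ℝ)
    have h1 := (Complex.imCLM.hasFDerivAt.comp w dQ).const_mul (2 : ℝ)
    have h2 := (Complex.imCLM.hasFDerivAt.comp w dP).const_mul (4 : ℝ)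
    have hk := hasFDerivAt_pi'.1 (hd (contDiffOn_diffCoords hs hF v)).hasFDerivAt
    have ek : ∀ k, (fun ζ ↦ diffCoords F ζ v k) =ᶠ[nhds w] fun ζ ↦
        frameCoords (α ζ) (β ζ) (fderiv ℝ α ζ v) (fderiv ℝ β ζ v) k :=
      fun k ↦ ee.mono fun ζ hζ ↦ congrFun hζ k
    funext k
    fin_cases k
    · have := congrArg (fun L : ℂ →L[ℝ] ℝ ↦ L u) ((hk 0).unique (h0.congr_of_eventuallyEq (ek 0)))
      refine this.trans ?_
      simp
      ring
    · have := congrArg (fun L : ℂ →L[ℝ] ℝ ↦ L u) ((hk 1).unique (h1.congr_of_eventuallyEq (ek 1)))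
      refine this.trans ?_
      simp
      ring
    · have := congrArg (fun L : ℂ →L[ℝ] ℝ ↦ L u) ((hk 2).unique (h2.congr_of_eventuallyEq (ek 2)))
      refine this.trans ?_
      simp
      ring
  have hn : α w * conj (α w) - β w * conj (β w) = 1 := by
    have := normSq_a (F w)
    rw [Complex.mul_conj, Complex.mul_conj]
    have h2 : Complex.normSq (α w) = 1 + Complex.normSq (β w) := this
    rw [h2]
    push_cast
    ring
  have ru := re_diffCoords hFw u
  have rv := re_diffCoords hFw v
  rw [key, key, diffCoords_eq hFw, diffCoords_eq hFw, fderiv_fderiv_apply hs ha hw u v,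
    fderiv_fderiv_apply hs hb hw u v]
  exact structure_equation hn ru rv _ _

end MaurerCartan

/-! ### Pointwise algebra of the complex frame. -/

section Algebra

/-- The connection is `-u × v` plus `5/2` times the `e₃` part: a volume form and a correction seen
only by the third coordinates. -/
lemma nabla_dotProduct (u v w : Fin 3 → ℂ) :
    nabla u v ⬝ᵥ w = -(u ⬝ᵥ v ⨯₃ w) + 5 / 2 * (u 2 * (v ⨯₃ w) 2) := by
  rw [nabla_eq]
  simp [dotProduct, Fin.sum_univ_three, cross_apply, Complex.real_smul]
  ring

lemma nabla_dotProduct_comm {R : Type*} [CommRing R] [Algebra ℝ R] (u v w : Fin 3 → R) :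
    nabla u v ⬝ᵥ w = -(v ⬝ᵥ nabla u w) := by
  rw [nabla_eq, nabla_eq]
  simp only [dotProduct, Fin.sum_univ_three, Algebra.smul_def, Matrix.cons_val]
  ring

variable {Z Zb n : Fin 3 → ℂ}

/-- The expansion of the inner product in a complex frame `Z`, `Zb`, `n`. -/
lemma dotProduct_expand (hZ : Z ⬝ᵥ Z = 0) (hZb : Zb ⬝ᵥ Zb = 0) (hn : n ⬝ᵥ n = 1)
    (hnZ : n ⬝ᵥ Z = 0) (hnZb : n ⬝ᵥ Zb = 0) (hl : Z ⬝ᵥ Zb ≠ 0) (u v : Fin 3 → ℂ) :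
    (Z ⬝ᵥ Zb) * (u ⬝ᵥ v) = (u ⬝ᵥ Z) * (v ⬝ᵥ Zb) + (u ⬝ᵥ Zb) * (v ⬝ᵥ Z) +
      (Z ⬝ᵥ Zb) * ((u ⬝ᵥ n) * (v ⬝ᵥ n)) := by
  set l := Z ⬝ᵥ Zb with hl'
  -- The dual frame of `Z, Zb, n` is `Zb / l, Z / l, n`. A one-sided inverse of a square matrix is
  -- two-sided, and the reversed product resolves the identity.
  have e : Matrix.of ![Z, Zb, n] * (Matrix.of ![l⁻¹ • Zb, l⁻¹ • Z, n])ᵀ = 1 := by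
    ext i j
    have : (Matrix.of ![Z, Zb, n] * (Matrix.of ![l⁻¹ • Zb, l⁻¹ • Z, n])ᵀ) i j =
      (![Z, Zb, n] i) ⬝ᵥ (![l⁻¹ • Zb, l⁻¹ • Z, n] j) := rfl
    rw [this]
    have h1 : Zb ⬝ᵥ Z = l := dotProduct_comm _ _
    have h2 : Z ⬝ᵥ n = 0 := (dotProduct_comm _ _).trans hnZ
    have h3 : Zb ⬝ᵥ n = 0 := (dotProduct_comm _ _).trans hnZb
    fin_cases i <;> fin_cases j <;> simp [hZ, hZb, hn, hnZ, hnZb, h1, h2, h3, ← hl', hl]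
  have e2 := mul_eq_one_comm.1 e
  have e3 : ∀ i j, Zb i * Z j + Z i * Zb j + l * (n i * n j) = l * (1 : Matrix _ _ ℂ) i j := by
    intro i j
    rw [← e2]
    simp [Matrix.mul_apply, Fin.sum_univ_three]
    field_simp
  have h00 := e3 0 0
  have h01 := e3 0 1
  have h02 := e3 0 2
  have h10 := e3 1 0
  have h11 := e3 1 1
  have h12 := e3 1 2
  have h20 := e3 2 0
  have h21 := e3 2 1
  have h22 := e3 2 2
  simp at h00 h01 h02 h10 h11 h12 h20 h21 h22
  simp only [dotProduct, Fin.sum_univ_three]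
  linear_combination (-(u 0 * v 0)) * h00 - (u 0 * v 1) * h01 - (u 0 * v 2) * h02
    - (u 1 * v 0) * h10 - (u 1 * v 1) * h11 - (u 1 * v 2) * h12
    - (u 2 * v 0) * h20 - (u 2 * v 1) * h21 - (u 2 * v 2) * h22

/-- Substitute `Z = -i (n × Z)` and expand `t × (n × Z) = (t · Z) n - (t · n) Z`. -/
lemma cross_of_tangent (hc : n ⨯₃ Z = I • Z) {t : Fin 3 → ℂ} (ht : t ⬝ᵥ n = 0) :
    t ⨯₃ Z = (-I * (t ⬝ᵥ Z)) • n := by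
  have h1 : Z = (-I) • (n ⨯₃ Z) := by rw [hc, smul_smul]; simp
  conv_lhs => rw [h1]
  rw [map_smul, mul_smul]
  congr 1
  funext k
  simp only [dotProduct, Fin.sum_univ_three] at ht
  fin_cases k <;> simp [cross_apply, dotProduct, Fin.sum_univ_three]
  · linear_combination (-Z 0) * ht
  · linear_combination (-Z 1) * ht
  · linear_combination (-Z 2) * ht

/-- The pointwise form of the computation that the modified Hopf differential is holomorphic: `Zz`,
`Zzb`, `Zbz`, `nz`, `nzb` are the derivatives of the frame. -/
lemma holomorphicity_identity (hZ : Z ⬝ᵥ Z = 0) (hZb : Zb ⬝ᵥ Zb = 0) (hn : n ⬝ᵥ n = 1)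
    (hnZ : n ⬝ᵥ Z = 0) (hnZb : n ⬝ᵥ Zb = 0) (hl : Z ⬝ᵥ Zb ≠ 0) (hc : n ⨯₃ Z = I • Z)
    {Zz Zzb Zbz nz nzb : Fin 3 → ℂ} {H : ℂ} (hH : H - I ≠ 0)
    (h1 : Zz ⬝ᵥ Z = 0) (h2 : Zzb ⬝ᵥ Z = 0) (h3 : Zbz ⬝ᵥ Zb = 0)
    (h4 : nz ⬝ᵥ n = 0) (h5 : nzb ⬝ᵥ n = 0)
    (h6 : nzb ⬝ᵥ Z + n ⬝ᵥ Zzb = 0)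
    (hs : Zzb + nabla Zb Z = Zbz + nabla Z Zb)
    (hm : -((nzb + nabla Zb n) ⬝ᵥ Z) = H * (Z ⬝ᵥ Zb)) :
    nabla Zbz n ⬝ᵥ Z + nabla Zb nz ⬝ᵥ Z + (nzb + nabla Zb n) ⬝ᵥ Zz +
      H * (Zz ⬝ᵥ Zb + Z ⬝ᵥ Zbz) - nabla Zzb n ⬝ᵥ Z - nabla Z nzb ⬝ᵥ Z - (nz + nabla Z n) ⬝ᵥ Zzb +
      5 / (2 * (H - I)) * (2 * Z 2 * Zzb 2) = 0 := by
  have hexp := dotProduct_expand hZ hZb hn hnZ hnZb hl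
  have hZbZ : Zb ⬝ᵥ Z = Z ⬝ᵥ Zb := dotProduct_comm _ _
  have hZn : Z ⬝ᵥ n = 0 := (dotProduct_comm _ _).trans hnZ
  have hZbn : Zb ⬝ᵥ n = 0 := (dotProduct_comm _ _).trans hnZb
  set l := Z ⬝ᵥ Zb with hl'
  have nabla_n : ∀ u, nabla u n ⬝ᵥ Z = I * (-(u ⬝ᵥ Z) + 5 / 2 * (u 2 * Z 2)) := fun u ↦ by
    rw [nabla_dotProduct, hc]
    simp
    ring
  have nabla_t : ∀ u t : Fin 3 → ℂ, t ⬝ᵥ n = 0 →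
      nabla u t ⬝ᵥ Z = -I * (t ⬝ᵥ Z) * (-(u ⬝ᵥ n) + 5 / 2 * (u 2 * n 2)) := fun u t ht ↦ by
    rw [nabla_dotProduct, cross_of_tangent hc ht]
    simp
    ring
  have self : ∀ u v : Fin 3 → ℂ, nabla u v ⬝ᵥ v = 0 := fun u v ↦ by
    rw [nabla_dotProduct, cross_self]
    simp
  have skew : ∀ u v w : Fin 3 → ℂ, nabla u v ⬝ᵥ w = -(nabla u w ⬝ᵥ v) := fun u v w ↦ by
    rw [nabla_dotProduct_comm, dotProduct_comm]
  -- `W` is `∇_∂̄ f_z = ∇_∂ f_z̄`. The first expression is orthogonal to `Z`, the second to `Zb`,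
  -- and the normal part is given by the mean curvature, so `W = H l n`.
  set W := Zzb + nabla Zb Z with hW
  have WZ : W ⬝ᵥ Z = 0 := by rw [hW, add_dotProduct, h2, self, add_zero]
  have WZb : W ⬝ᵥ Zb = 0 := by rw [hs, add_dotProduct, h3, self, add_zero]
  have Wn : W ⬝ᵥ n = H * l := by
    rw [← hm, hW, add_dotProduct, add_dotProduct, skew Zb Z n, dotProduct_comm Zzb]
    linear_combination h6
  have hWeq : ∀ v, W ⬝ᵥ v = H * l * (n ⬝ᵥ v) := fun v ↦ by
    have := hexp W v
    rw [WZ, WZb, Wn, dotProduct_comm v n] at this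
    exact mul_left_cancel₀ hl (by linear_combination this)
  have W2 : W 2 = H * l * n 2 := by
    have := hWeq (Pi.single 2 1)
    simpa using this
  have hcr : Zb ⨯₃ Z = (-I * l) • n := by rw [← hZbZ]; exact cross_of_tangent hc hZbn
  have hcr2 : Zb 0 * Z 1 - Zb 1 * Z 0 = -I * l * n 2 := by
    have := congrFun hcr 2
    simpa [cross_apply] using this
  have n2 : nabla Zb Z 2 = I * l * n 2 := by
    rw [nabla_eq]
    simp
    linear_combination -hcr2
  have n2' : nabla Z Zb 2 = -I * l * n 2 := by
    rw [nabla_eq]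
    simp
    linear_combination hcr2
  -- The connection term turns the factor `H` into `H - i`, which is the denominator in the
  -- correction term; with the opposite orientation it would be `H + i`.
  have Zzb2 : Zzb 2 = (H - I) * l * n 2 := by
    have : W 2 = Zzb 2 + nabla Zb Z 2 := rfl
    rw [W2, n2] at this
    linear_combination -this
  have Zbz2 : Zbz 2 = (H + I) * l * n 2 := by
    have : W 2 = Zbz 2 + nabla Z Zb 2 := by rw [hs]; rfl
    rw [W2, n2'] at this
    linear_combination -this
  have nzbZ : nzb ⬝ᵥ Z = -(H * l) - I * (-l + 5 / 2 * (Zb 2 * Z 2)) := by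
    rw [add_dotProduct, nabla_n, hZbZ] at hm
    linear_combination -hm
  have ZbzZ : Zbz ⬝ᵥ Z = 5 / 2 * I * l * (Z 2 * n 2) := by
    have : W ⬝ᵥ Z = Zbz ⬝ᵥ Z + nabla Z Zb ⬝ᵥ Z := by rw [hs, add_dotProduct]
    rw [WZ, nabla_t Z Zb hZbn, hZn, hZbZ] at this
    linear_combination -this
  have ZzbZb : Zzb ⬝ᵥ Zb = -(5 / 2 * I * l * (Zb 2 * n 2)) := by
    have : W ⬝ᵥ Zb = Zzb ⬝ᵥ Zb + nabla Zb Z ⬝ᵥ Zb := by rw [hW, add_dotProduct]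
    rw [WZb, skew, nabla_t Zb Zb hZbn, hZbn, hZbZ] at this
    linear_combination -this
  -- This cancels half of the derivative of `H l`, namely the summand with `Zz`.
  have tau : (nzb + nabla Zb n) ⬝ᵥ Zz = -H * (Zz ⬝ᵥ Zb) := by
    have := hexp (nzb + nabla Zb n) Zz
    have h0 : (nzb + nabla Zb n) ⬝ᵥ n = 0 := by rw [add_dotProduct, h5, self, add_zero]
    rw [h0, h1] at this
    exact mul_left_cancel₀ hl (by linear_combination this - (Zz ⬝ᵥ Zb) * hm)
  -- The unknown `nz ⬝ᵥ Z`, which is the Hopf coefficient up to first-order terms, cancels against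
  -- `nabla Zb nz ⬝ᵥ Z`.
  have sigma : (nz + nabla Z n) ⬝ᵥ Zzb =
      -(5 / 2 * I * (Zb 2 * n 2)) * (nz ⬝ᵥ Z + I * (5 / 2 * (Z 2 * Z 2))) := by
    have := hexp (nz + nabla Z n) Zzb
    have h0 : (nz + nabla Z n) ⬝ᵥ n = 0 := by rw [add_dotProduct, h4, self, add_zero]
    have h0' : (nz + nabla Z n) ⬝ᵥ Z = nz ⬝ᵥ Z + I * (5 / 2 * (Z 2 * Z 2)) := by
      rw [add_dotProduct, nabla_n, hZ]
      ring
    rw [h0, h0', h2, ZzbZb] at this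
    exact mul_left_cancel₀ hl (by linear_combination this)
  have hquot : 5 / (2 * (H - I)) * (2 * Z 2 * ((H - I) * l * n 2)) = 5 * (Z 2 * l * n 2) := by
    field_simp
  rw [tau, sigma, nabla_n, nabla_n, nabla_t Zb nz h4, nabla_t Z nzb h5, nzbZ, h2, hZn, hZbn,
    dotProduct_comm Z Zbz, ZbzZ, Zzb2, Zbz2, hquot]
  have hI : I * I = -1 := Complex.I_mul_I
  linear_combination (5 * l * Z 2 * n 2) * hI

end Algebra

/-! ### Wirtinger calculus for real differentiable functions. -/

section Wirtinger

/-- The operator `(∂/∂x + c ∂/∂y) / 2`: this is `∂` for `c = -i` and its conjugate for `c = i`. -/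
def cderiv (c : ℂ) (h : ℂ → ℂ) (w : ℂ) : ℂ := (fderiv ℝ h w 1 + c * fderiv ℝ h w I) / 2

/-- The operator `cderiv` on vector valued functions. -/
def vderiv (c : ℂ) (h : ℂ → Fin 3 → ℂ) (w : ℂ) : Fin 3 → ℂ := fun k ↦ cderiv c (fun ζ ↦ h ζ k) w

lemma wirtinger_eq_cderiv (h : ℂ → ℂ) (w : ℂ) : wirtinger h w = cderiv (-I) h w := by
  rw [wirtinger, cderiv]
  ring

variable {c w : ℂ} {s : Set ℂ}

section Scalar

variable {g h : ℂ → ℂ}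

lemma cderiv_add (hg : DifferentiableAt ℝ g w) (hh : DifferentiableAt ℝ h w) :
    cderiv c (fun ζ ↦ g ζ + h ζ) w = cderiv c g w + cderiv c h w := by
  simp only [cderiv, fderiv_fun_add hg hh, add_apply]
  ring

lemma cderiv_mul (hg : DifferentiableAt ℝ g w) (hh : DifferentiableAt ℝ h w) :
    cderiv c (fun ζ ↦ g ζ * h ζ) w = cderiv c g w * h w + g w * cderiv c h w := by
  simp only [cderiv, fderiv_fun_mul hg hh]
  simp
  ring

lemma cderiv_const_mul (r : ℂ) (hh : DifferentiableAt ℝ h w) :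
    cderiv c (fun ζ ↦ r * h ζ) w = r * cderiv c h w := by
  simp only [cderiv, fderiv_const_mul hh]
  simp
  ring

lemma cderiv_congr (hs : IsOpen s) (hw : w ∈ s) (hgh : ∀ ζ ∈ s, g ζ = h ζ) :
    cderiv c g w = cderiv c h w := by
  have : g =ᶠ[nhds w] h := by
    filter_upwards [hs.mem_nhds hw] with ζ hζ using hgh ζ hζ
  rw [cderiv, cderiv, this.fderiv_eq]

lemma cderiv_const (r : ℂ) : cderiv c (fun _ ↦ r) w = 0 := by
  simp [cderiv]

lemma contDiffOn_cderiv (hs : IsOpen s) (hh : ContDiffOn ℝ ∞ h s) :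
    ContDiffOn ℝ ∞ (cderiv c h) s :=
  ((contDiffOn_fderiv_apply hs hh 1).add
    (contDiffOn_const.mul (contDiffOn_fderiv_apply hs hh I))).div_const 2

/-- Symmetry of second derivatives; needed for the cancellation of the mixed derivative of the
normal. -/
lemma cderiv_cderiv_comm (hs : IsOpen s) (hh : ContDiffOn ℝ ∞ h s) (hw : w ∈ s) (c d : ℂ) :
    cderiv c (cderiv d h) w = cderiv d (cderiv c h) w := by
  have hd : ∀ u, DifferentiableAt ℝ (fun ζ ↦ fderiv ℝ h ζ u) w := fun u ↦
    ((contDiffOn_fderiv_apply hs hh u).differentiableOn (by simp)).differentiableAt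
      (hs.mem_nhds hw)
  have e : ∀ c u, fderiv ℝ (cderiv c h) w u =
      (fderiv ℝ (fun ζ ↦ fderiv ℝ h ζ 1) w u + c * fderiv ℝ (fun ζ ↦ fderiv ℝ h ζ I) w u) / 2 := by
    intro c u
    have := (((hd 1).hasFDerivAt.add ((hd I).hasFDerivAt.const_mul c)).mul_const (2⁻¹ : ℂ)).fderiv
    have e0 : cderiv c h = fun ζ ↦ (fderiv ℝ h ζ 1 + c * fderiv ℝ h ζ I) * 2⁻¹ := by
      funext ζ
      rw [cderiv, div_eq_mul_inv]
    rw [e0]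
    refine (congrArg (fun L : ℂ →L[ℝ] ℂ ↦ L u) this).trans ?_
    simp
    ring
  rw [cderiv, cderiv, e, e, e, e, fderiv_fderiv_apply hs hh hw 1 I]
  ring

/-- With `c = I` the operator is `∂̄`, so its vanishing is the Cauchy-Riemann equation. -/
lemma differentiableAt_of_cderiv_eq_zero (hh : DifferentiableAt ℝ h w) (h0 : cderiv I h w = 0) :
    DifferentiableAt ℂ h w := by
  refine differentiableAt_complex_iff_differentiableAt_real.2 ⟨hh, ?_⟩
  rw [cderiv] at h0
  have : fderiv ℝ h w 1 + I * fderiv ℝ h w I = 0 := by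
    linear_combination 2 * h0
  rw [smul_eq_mul]
  linear_combination (-I) * this + (fderiv ℝ h w I) * Complex.I_mul_I

end Scalar

section Vector

variable {u v : ℂ → Fin 3 → ℂ}

lemma vderiv_add (hu : DifferentiableAt ℝ u w) (hv : DifferentiableAt ℝ v w) :
    vderiv c (fun ζ ↦ u ζ + v ζ) w = vderiv c u w + vderiv c v w :=
  funext fun k ↦ cderiv_add (differentiableAt_pi.1 hu k) (differentiableAt_pi.1 hv k)

lemma cderiv_dotProduct (hu : DifferentiableAt ℝ u w) (hv : DifferentiableAt ℝ v w) :
    cderiv c (fun ζ ↦ u ζ ⬝ᵥ v ζ) w = vderiv c u w ⬝ᵥ v w + u w ⬝ᵥ vderiv c v w := by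
  have hu' := differentiableAt_pi.1 hu
  have hv' := differentiableAt_pi.1 hv
  have hm : ∀ k, DifferentiableAt ℝ (fun ζ ↦ u ζ k * v ζ k) w := fun k ↦ (hu' k).mul (hv' k)
  simp only [dotProduct, Fin.sum_univ_three]
  rw [cderiv_add ((hm 0).fun_add (hm 1)) (hm 2),
    cderiv_add (hm 0) (hm 1), cderiv_mul (hu' 0) (hv' 0),
    cderiv_mul (hu' 1) (hv' 1), cderiv_mul (hu' 2) (hv' 2)]
  simp only [vderiv]
  ring

/-- A Leibniz rule without extra term, since in the left invariant frame `nabla` is bilinear with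
constant coefficients. -/
lemma vderiv_nabla (hu : DifferentiableAt ℝ u w) (hv : DifferentiableAt ℝ v w) :
    vderiv c (fun ζ ↦ nabla (u ζ) (v ζ)) w =
      nabla (vderiv c u w) (v w) + nabla (u w) (vderiv c v w) := by
  have hu' := differentiableAt_pi.1 hu
  have hv' := differentiableAt_pi.1 hv
  have key : ∀ (i j k l : Fin 3) (p q : ℂ),
      cderiv c (fun ζ ↦ p * (u ζ i * v ζ j) + q * (u ζ k * v ζ l)) w =
        p * (vderiv c u w i * v w j + u w i * vderiv c v w j) +
        q * (vderiv c u w k * v w l + u w k * vderiv c v w l) := by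
    intro i j k l p q
    have hm : ∀ k l, DifferentiableAt ℝ (fun ζ ↦ u ζ k * v ζ l) w := fun k l ↦ (hu' k).mul (hv' l)
    rw [cderiv_add ((hm i j).const_mul p) ((hm k l).const_mul q),
      cderiv_const_mul p (hm i j), cderiv_const_mul q (hm k l),
      cderiv_mul (hu' i) (hv' j), cderiv_mul (hu' k) (hv' l)]
    rfl
  -- Each component of the connection is a combination of just two products, the shape that `key`
  -- differentiates.
  have e : ∀ x y : Fin 3 → ℂ, nabla x y = ![(-1) * (x 1 * y 2) + (-(3 / 2)) * (x 2 * y 1),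
      1 * (x 0 * y 2) + 3 / 2 * (x 2 * y 0), 1 * (x 1 * y 0) + (-1) * (x 0 * y 1)] := fun x y ↦ by
    rw [nabla_eq]
    funext k
    fin_cases k <;> simp [Complex.real_smul] <;> ring
  funext k
  simp only [vderiv, e]
  fin_cases k
  · refine (key 1 2 2 1 _ _).trans ?_
    simp [vderiv]
    ring
  · refine (key 0 2 2 0 _ _).trans ?_
    simp [vderiv]
    ring
  · refine (key 1 0 0 1 _ _).trans ?_
    simp [vderiv]
    ring

lemma contDiffOn_vderiv (hs : IsOpen s) (hu : ContDiffOn ℝ ∞ u s) :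
    ContDiffOn ℝ ∞ (vderiv c u) s :=
  contDiffOn_pi.2 fun k ↦ contDiffOn_cderiv hs (contDiffOn_pi.1 hu k)

lemma vderiv_vderiv_comm (hs : IsOpen s) (hu : ContDiffOn ℝ ∞ u s) (hw : w ∈ s) (c d : ℂ) :
    vderiv c (vderiv d u) w = vderiv d (vderiv c u) w :=
  funext fun k ↦ cderiv_cderiv_comm hs (contDiffOn_pi.1 hu k) hw c d

lemma contDiffOn_dotProduct (hu : ContDiffOn ℝ ∞ u s) (hv : ContDiffOn ℝ ∞ v s) :
    ContDiffOn ℝ ∞ (fun ζ ↦ u ζ ⬝ᵥ v ζ) s :=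
  ContDiffOn.sum fun k _ ↦ (contDiffOn_pi.1 hu k).mul (contDiffOn_pi.1 hv k)

lemma contDiffOn_nabla (hu : ContDiffOn ℝ ∞ u s) (hv : ContDiffOn ℝ ∞ v s) :
    ContDiffOn ℝ ∞ (fun ζ ↦ nabla (u ζ) (v ζ)) s :=
  contDiffOn_pi.2 fun i ↦ ContDiffOn.sum fun k _ ↦ ContDiffOn.sum fun j _ ↦
    ((contDiffOn_pi.1 hu k).mul (contDiffOn_pi.1 hv j)).const_smul (connCoeff k j i)

end Vector

end Wirtinger

/-- A complex frame `Z = f_z`, `Zb`, `n` along an open set: the equations of a conformal immersion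
of constant mean curvature `H`. -/
structure IsCMCFrame (s : Set ℂ) (Z Zb n : ℂ → Fin 3 → ℂ) (H : ℂ) : Prop where
  smooth_Z : ContDiffOn ℝ ∞ Z s
  smooth_Zb : ContDiffOn ℝ ∞ Zb s
  smooth_n : ContDiffOn ℝ ∞ n s
  Z_Z : ∀ w ∈ s, Z w ⬝ᵥ Z w = 0
  Zb_Zb : ∀ w ∈ s, Zb w ⬝ᵥ Zb w = 0
  n_n : ∀ w ∈ s, n w ⬝ᵥ n w = 1
  n_Z : ∀ w ∈ s, n w ⬝ᵥ Z w = 0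
  n_Zb : ∀ w ∈ s, n w ⬝ᵥ Zb w = 0
  Z_Zb : ∀ w ∈ s, Z w ⬝ᵥ Zb w ≠ 0
  cross : ∀ w ∈ s, n w ⨯₃ Z w = I • Z w
  symm : ∀ w ∈ s, vderiv I Z w + nabla (Zb w) (Z w) = vderiv (-I) Zb w + nabla (Z w) (Zb w)
  mean : ∀ w ∈ s, -((vderiv I n w + nabla (Zb w) (n w)) ⬝ᵥ Z w)
    - (vderiv (-I) n w + nabla (Z w) (n w)) ⬝ᵥ Zb w = 2 * (H * (Z w ⬝ᵥ Zb w))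

/-! ### Holomorphicity for a complex frame of constant mean curvature. -/

namespace IsCMCFrame

variable {s : Set ℂ} {Z Zb n : ℂ → Fin 3 → ℂ} {H : ℂ}

lemma cderiv_orthogonal {c : ℂ} {u v : ℂ → Fin 3 → ℂ} {r : ℂ} (hs : IsOpen s)
    (hu : ContDiffOn ℝ ∞ u s) (hv : ContDiffOn ℝ ∞ v s) (huv : ∀ w ∈ s, u w ⬝ᵥ v w = r) :
    ∀ w ∈ s, vderiv c u w ⬝ᵥ v w + u w ⬝ᵥ vderiv c v w = 0 := fun w hw ↦ by
  rw [← cderiv_dotProduct ((hu.differentiableOn (by simp)).differentiableAt (hs.mem_nhds hw))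
    ((hv.differentiableOn (by simp)).differentiableAt (hs.mem_nhds hw)),
    cderiv_congr hs hw huv, cderiv_const]

lemma cderiv_orthogonal_self {c : ℂ} {u : ℂ → Fin 3 → ℂ} {r : ℂ} (hs : IsOpen s)
    (hu : ContDiffOn ℝ ∞ u s) (huv : ∀ w ∈ s, u w ⬝ᵥ u w = r) :
    ∀ w ∈ s, vderiv c u w ⬝ᵥ u w = 0 := fun w hw ↦ by
  have := cderiv_orthogonal (c := c) hs hu hu huv w hw
  rw [dotProduct_comm (u w)] at this
  linear_combination this / 2

/-- The two summands of the trace are equal: by orthogonality to `n` they are the normal parts of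
`∇_∂̄ Z` and of `∇_∂ Zb`, which coincide by `symm`. -/
lemma mean' (h : IsCMCFrame s Z Zb n H) (hs : IsOpen s) :
    ∀ w ∈ s, -((vderiv I n w + nabla (Zb w) (n w)) ⬝ᵥ Z w) = H * (Z w ⬝ᵥ Zb w) := fun w hw ↦ by
  have h1 := cderiv_orthogonal (c := I) hs h.smooth_n h.smooth_Z h.n_Z w hw
  have h2 := cderiv_orthogonal (c := -I) hs h.smooth_n h.smooth_Zb h.n_Zb w hw
  have h3 := congrArg (fun x ↦ n w ⬝ᵥ x) (h.symm w hw)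
  have h4 := h.mean w hw
  simp only [add_dotProduct, dotProduct_add, nabla_dotProduct_comm (Zb w) (n w) (Z w),
    nabla_dotProduct_comm (Z w) (n w) (Zb w)] at h1 h2 h3 h4 ⊢
  linear_combination h4 / 2 - h1 / 2 + h2 / 2 + h3 / 2

/-- Differentiate `⟨n, Z⟩ = 0` and use that the connection is metric. The derivative moves from `Z`
to `n`, which makes the Hopf coefficient comparable with `mean'`. -/
lemma hopf_eq (h : IsCMCFrame s Z Zb n H) (hs : IsOpen s) :
    ∀ w ∈ s, (vderiv (-I) Z w + nabla (Z w) (Z w)) ⬝ᵥ n w =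
      -((vderiv (-I) n w + nabla (Z w) (n w)) ⬝ᵥ Z w) := fun w hw ↦ by
  have h1 := cderiv_orthogonal (c := -I) hs h.smooth_n h.smooth_Z h.n_Z w hw
  rw [dotProduct_comm _ (n w), dotProduct_add, add_dotProduct,
    nabla_dotProduct_comm (Z w) (n w) (Z w)]
  linear_combination h1

lemma differentiableOn (h : IsCMCFrame s Z Zb n H) (hs : IsOpen s) (hH : H - I ≠ 0) :
    DifferentiableOn ℂ (fun w ↦ (vderiv (-I) Z w + nabla (Z w) (Z w)) ⬝ᵥ n w +
      5 / (2 * (H - I)) * Z w 2 ^ 2) s := by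
  refine DifferentiableOn.congr (f := fun w ↦ -1 * ((vderiv (-I) n w + nabla (Z w) (n w)) ⬝ᵥ Z w) +
    5 / (2 * (H - I)) * (Z w 2 * Z w 2)) (fun w hw ↦ ?_) fun w hw ↦ by
      rw [h.hopf_eq hs w hw]; ring
  have hd : ∀ {E : Type} [NormedAddCommGroup E] [NormedSpace ℝ E] {g : ℂ → E},
      ContDiffOn ℝ ∞ g s → DifferentiableAt ℝ g w := fun g ↦
    (g.differentiableOn (by simp)).differentiableAt (hs.mem_nhds hw)
  have dn := contDiffOn_vderiv (c := -I) hs h.smooth_n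
  have dnb := contDiffOn_vderiv (c := I) hs h.smooth_n
  have cZn := contDiffOn_nabla h.smooth_Z h.smooth_n
  have cZbn := contDiffOn_nabla h.smooth_Zb h.smooth_n
  have c2 := contDiffOn_pi.1 h.smooth_Z 2
  have t1 := contDiffOn_dotProduct (dn.add cZn) h.smooth_Z
  have t1b := contDiffOn_dotProduct (dnb.add cZbn) h.smooth_Z
  have t1' : ContDiffOn ℝ ∞
    (fun w ↦ -1 * ((vderiv (-I) n w + nabla (Z w) (n w)) ⬝ᵥ Z w)) s := contDiffOn_const.mul t1
  have t2' : ContDiffOn ℝ ∞ (fun w ↦ 5 / (2 * (H - I)) * (Z w 2 * Z w 2)) s :=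
    contDiffOn_const.mul (c2.mul c2)
  refine (differentiableAt_of_cderiv_eq_zero (hd (t1'.add t2')) ?_).differentiableWithinAt
  have dZ := hd h.smooth_Z
  have dZb := hd h.smooth_Zb
  have dN := hd h.smooth_n
  -- Differentiating the mean curvature equation by `∂` produces the same term `⟨∂̄∂n, Z⟩` as `∂̄`
  -- of the Hopf coefficient; the difference involves first derivatives of the frame only. Constancy
  -- of `H` enters here.
  have hm : cderiv (-I) (fun w ↦ -1 * ((vderiv I n w + nabla (Zb w) (n w)) ⬝ᵥ Z w)) w =
      cderiv (-I) (fun w ↦ H * (Z w ⬝ᵥ Zb w)) w :=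
    cderiv_congr hs hw fun ζ hζ ↦ by rw [← h.mean' hs ζ hζ]; ring
  rw [cderiv_const_mul _ (hd t1b), cderiv_const_mul _
      (hd (contDiffOn_dotProduct h.smooth_Z h.smooth_Zb)),
    cderiv_dotProduct (hd (dnb.add cZbn)) dZ, cderiv_dotProduct dZ dZb,
    vderiv_add (hd dnb) (hd cZbn), vderiv_nabla dZb dN] at hm
  rw [cderiv_add (hd t1') (hd t2'), cderiv_const_mul _ (hd t1),
    cderiv_const_mul _ (hd (c2.mul c2)), cderiv_mul (hd c2) (hd c2),
    cderiv_dotProduct (hd (dn.add cZn)) dZ, vderiv_add (hd dn) (hd cZn), vderiv_nabla dZ dN,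
    vderiv_vderiv_comm hs h.smooth_n hw I (-I)]
  have key := holomorphicity_identity (h.Z_Z w hw) (h.Zb_Zb w hw) (h.n_n w hw) (h.n_Z w hw)
    (h.n_Zb w hw) (h.Z_Zb w hw) (h.cross w hw) hH
    (cderiv_orthogonal_self (c := -I) hs h.smooth_Z h.Z_Z w hw)
    (cderiv_orthogonal_self (c := I) hs h.smooth_Z h.Z_Z w hw)
    (cderiv_orthogonal_self (c := -I) hs h.smooth_Zb h.Zb_Zb w hw)
    (cderiv_orthogonal_self (c := -I) hs h.smooth_n h.n_n w hw)
    (cderiv_orthogonal_self (c := I) hs h.smooth_n h.n_n w hw)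
    (cderiv_orthogonal (c := I) hs h.smooth_n h.smooth_Z h.n_Z w hw)
    (h.symm w hw) (h.mean' hs w hw)
  have e2 : cderiv I (fun ζ ↦ Z ζ 2) w = vderiv I Z w 2 := rfl
  rw [e2]
  simp only [add_dotProduct] at hm key ⊢
  linear_combination key + hm

end IsCMCFrame

/-! ### From real to complex frames. -/

section RealFrame

/-- The vectors `n × X` and `Y` have equal length, and their inner product is the positive
determinant. By the Gram determinant its square is the product of the squared lengths, so the
vectors are equal; a second cross product with `n` gives the other identity. -/
lemma cross_eq_of_det_pos {X Y n : Fin 3 → ℝ} (hXY : X ⬝ᵥ X = Y ⬝ᵥ Y) (h0 : X ⬝ᵥ Y = 0)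
    (hn : n ⬝ᵥ n = 1) (hnX : n ⬝ᵥ X = 0) (hnY : n ⬝ᵥ Y = 0)
    (hd : 0 < (Matrix.of ![X, Y, n]).det) : n ⨯₃ X = Y ∧ n ⨯₃ Y = -X := by
  have ed : (Matrix.of ![X, Y, n]).det = (n ⨯₃ X) ⬝ᵥ Y := by
    rw [Matrix.det_fin_three, cross_apply]
    simp [dotProduct, Fin.sum_univ_three]
    ring
  rw [ed] at hd
  have gram : ((n ⨯₃ X) ⬝ᵥ Y) ^ 2 = (X ⬝ᵥ X) * (Y ⬝ᵥ Y) * (n ⬝ᵥ n) +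
      2 * (X ⬝ᵥ Y) * (n ⬝ᵥ X) * (n ⬝ᵥ Y) - (X ⬝ᵥ X) * (n ⬝ᵥ Y) ^ 2 - (Y ⬝ᵥ Y) * (n ⬝ᵥ X) ^ 2 -
      (n ⬝ᵥ n) * (X ⬝ᵥ Y) ^ 2 := by
    rw [cross_apply]
    simp [dotProduct, Fin.sum_univ_three]
    ring
  have hnn : (n ⨯₃ X) ⬝ᵥ (n ⨯₃ X) = Y ⬝ᵥ Y := by
    rw [cross_dot_cross, hn, hnX, ← hXY]
    ring
  rw [hXY, h0, hn, hnX, hnY] at gram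
  have hY0 : 0 ≤ Y ⬝ᵥ Y := by
    rw [dotProduct, Fin.sum_univ_three]
    nlinarith [mul_self_nonneg (Y 0), mul_self_nonneg (Y 1), mul_self_nonneg (Y 2)]
  have hde : (n ⨯₃ X) ⬝ᵥ Y = Y ⬝ᵥ Y := by
    refine (sq_eq_sq₀ hd.le hY0).1 ?_
    rw [gram]
    ring
  have hX : n ⨯₃ X = Y := by
    rw [← sub_eq_zero, ← dotProduct_self_eq_zero, sub_dotProduct, dotProduct_sub, dotProduct_sub,
      hnn, hde, dotProduct_comm Y (n ⨯₃ X), hde]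
    ring
  refine ⟨hX, ?_⟩
  rw [← hX]
  funext k
  simp only [dotProduct, Fin.sum_univ_three] at hn hnX
  fin_cases k <;> simp [cross_apply]
  · linear_combination n 0 * hnX - X 0 * hn
  · linear_combination n 1 * hnX - X 1 * hn
  · linear_combination n 2 * hnX - X 2 * hn

lemma dotProduct_self_pos_of_det {X Y n : Fin 3 → ℝ} (hd : 0 < (Matrix.of ![X, Y, n]).det) :
    0 < X ⬝ᵥ X := by
  have h0 : 0 ≤ X ⬝ᵥ X := by
    rw [dotProduct, Fin.sum_univ_three]
    nlinarith [mul_self_nonneg (X 0), mul_self_nonneg (X 1), mul_self_nonneg (X 2)]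
  refine h0.lt_of_ne fun h ↦ ?_
  have hX : X = 0 := dotProduct_self_eq_zero.1 h.symm
  rw [hX, Matrix.det_fin_three] at hd
  simp at hd

/-- Complexification of a vector valued function, `u + c v`, divided by two. -/
def complexify (c : ℂ) (u v : Fin 3 → ℝ) : Fin 3 → ℂ := fun k ↦ ((u k : ℂ) + c * (v k : ℂ)) / 2

/-- The complex vector with given real coordinates. -/
def toComplex (u : Fin 3 → ℝ) : Fin 3 → ℂ := fun k ↦ (u k : ℂ)

lemma nabla_toComplex (u v : Fin 3 → ℝ) :
    nabla (toComplex u) (toComplex v) = toComplex (nabla u v) := by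
  funext k
  simp only [nabla_eq]
  fin_cases k <;> simp [toComplex, Complex.real_smul]

lemma dotProduct_toComplex (u v : Fin 3 → ℝ) : toComplex u ⬝ᵥ toComplex v = (u ⬝ᵥ v : ℝ) := by
  simp [toComplex, dotProduct]

lemma cross_toComplex (u v : Fin 3 → ℝ) :
    toComplex u ⨯₃ toComplex v = toComplex (u ⨯₃ v) := by
  funext k
  fin_cases k <;> simp [toComplex, cross_apply]

lemma complexify_eq (c : ℂ) (u v : Fin 3 → ℝ) :
    complexify c u v = (1 / 2 : ℂ) • (toComplex u + c • toComplex v) := by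
  funext k
  simp [complexify, toComplex]
  ring

lemma nabla_add_smul (u v u' v' : Fin 3 → ℂ) (p q c d : ℂ) :
    nabla (p • (u + c • v)) (q • (u' + d • v')) = (p * q) •
      (nabla u u' + d • nabla u v' + c • nabla v u' + (c * d) • nabla v v') := by
  simp only [nabla_eq]
  funext k
  fin_cases k <;> simp [Complex.real_smul] <;> ring

lemma complexify_add_nabla (c : ℂ) (u v m x y : Fin 3 → ℝ) : complexify c u v +
    nabla (complexify c x y) (toComplex m) = complexify c (u + nabla x m) (v + nabla y m) := by
  have := nabla_add_smul (toComplex x) (toComplex y) (toComplex m) 0 (1 / 2) 1 c 0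
  simp only [zero_smul, add_zero, mul_zero, mul_one, one_smul] at this
  simp only [complexify_eq, this, nabla_toComplex]
  funext k
  simp [toComplex]
  ring

variable {X Y n : ℂ → Fin 3 → ℝ} {s : Set ℂ} {w : ℂ}

lemma contDiffOn_toComplex (hX : ContDiffOn ℝ ∞ X s) :
    ContDiffOn ℝ ∞ (fun w ↦ toComplex (X w)) s :=
  contDiffOn_pi.2 fun k ↦ Complex.ofRealCLM.contDiff.comp_contDiffOn (contDiffOn_pi.1 hX k)

lemma contDiffOn_complexify (c : ℂ) (hX : ContDiffOn ℝ ∞ X s) (hY : ContDiffOn ℝ ∞ Y s) :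
    ContDiffOn ℝ ∞ (fun w ↦ complexify c (X w) (Y w)) s := by
  simp only [complexify_eq]
  exact ((contDiffOn_toComplex hX).add ((contDiffOn_toComplex hY).const_smul c)).const_smul
    (1 / 2 : ℂ)

lemma vderiv_toComplex (d : ℂ) (hX : DifferentiableAt ℝ X w) :
    vderiv d (fun w ↦ toComplex (X w)) w = complexify d (fderiv ℝ X w 1) (fderiv ℝ X w I) := by
  funext k
  have e : fderiv ℝ (fun w ↦ toComplex (X w) k) w =
      Complex.ofRealCLM.comp ((ContinuousLinearMap.proj k).comp (fderiv ℝ X w)) :=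
    (Complex.ofRealCLM.hasFDerivAt.comp w (hasFDerivAt_pi'.1 hX.hasFDerivAt k)).fderiv
  simp [vderiv, cderiv, e, complexify]

lemma vderiv_complexify (c d : ℂ) (hX : DifferentiableAt ℝ X w) (hY : DifferentiableAt ℝ Y w) :
    vderiv d (fun w ↦ complexify c (X w) (Y w)) w = (1 / 2 : ℂ) •
      (complexify d (fderiv ℝ X w 1) (fderiv ℝ X w I) +
        c • complexify d (fderiv ℝ Y w 1) (fderiv ℝ Y w I)) := by
  rw [← vderiv_toComplex d hX, ← vderiv_toComplex d hY]
  have hc : ∀ {X : ℂ → Fin 3 → ℝ}, DifferentiableAt ℝ X w → ∀ k,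
      DifferentiableAt ℝ (fun w ↦ toComplex (X w) k) w := fun hX k ↦
    Complex.ofRealCLM.differentiableAt.comp w (differentiableAt_pi.1 hX k)
  funext k
  have e : (fun w ↦ complexify c (X w) (Y w) k) =
      fun w ↦ (1 / 2) * (toComplex (X w) k + c * toComplex (Y w) k) := by
    funext w
    rw [complexify_eq]
    rfl
  change cderiv d _ w = _
  rw [e, cderiv_const_mul _ ((hc hX k).fun_add ((hc hY k).const_mul c)),
    cderiv_add (hc hX k) ((hc hY k).const_mul c), cderiv_const_mul c (hc hY k)]
  rfl

/-- Isotropy of the complex frame is conformality, and `cross` is orientation. The torsion identity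
is the only nontrivial part of `symm`; in the sum `mean` the mixed terms cancel and the real trace
is left. -/
lemma isCMCFrame_of_real {H : ℝ} (hs : IsOpen s) (hX : ContDiffOn ℝ ∞ X s)
    (hY : ContDiffOn ℝ ∞ Y s) (hn : ContDiffOn ℝ ∞ n s)
    (hXY : ∀ w ∈ s, X w ⬝ᵥ X w = Y w ⬝ᵥ Y w) (h0 : ∀ w ∈ s, X w ⬝ᵥ Y w = 0)
    (hnn : ∀ w ∈ s, n w ⬝ᵥ n w = 1) (hnX : ∀ w ∈ s, n w ⬝ᵥ X w = 0)
    (hnY : ∀ w ∈ s, n w ⬝ᵥ Y w = 0)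
    (hdet : ∀ w ∈ s, 0 < (Matrix.of ![X w, Y w, n w]).det)
    (hsymm : ∀ w ∈ s, fderiv ℝ Y w 1 + nabla (X w) (Y w) = fderiv ℝ X w I + nabla (Y w) (X w))
    (hmean : ∀ w ∈ s, -((fderiv ℝ n w 1 + nabla (X w) (n w)) ⬝ᵥ X w) -
      (fderiv ℝ n w I + nabla (Y w) (n w)) ⬝ᵥ Y w = 2 * H * (X w ⬝ᵥ X w)) :
    IsCMCFrame s (fun w ↦ complexify (-I) (X w) (Y w)) (fun w ↦ complexify I (X w) (Y w))
      (fun w ↦ toComplex (n w)) H := by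
  have hd : ∀ {g : ℂ → Fin 3 → ℝ}, ContDiffOn ℝ ∞ g s → ∀ w ∈ s, DifferentiableAt ℝ g w :=
    fun g w hw ↦ (g.differentiableOn (by simp)).differentiableAt (hs.mem_nhds hw)
  have hI : I * I = -1 := Complex.I_mul_I
  have dot : ∀ (c d : ℂ) (u v u' v' : Fin 3 → ℝ), complexify c u v ⬝ᵥ complexify d u' v' =
      ((u ⬝ᵥ u' : ℝ) + d * (u ⬝ᵥ v' : ℝ) + c * (v ⬝ᵥ u' : ℝ) + c * d * (v ⬝ᵥ v' : ℝ)) / 4 := by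
    intro c d u v u' v'
    simp only [complexify_eq, ← dotProduct_toComplex, smul_dotProduct, dotProduct_smul,
      add_dotProduct, dotProduct_add, smul_eq_mul]
    ring
  have dotn : ∀ (d : ℂ) (u u' v' : Fin 3 → ℝ), toComplex u ⬝ᵥ complexify d u' v' =
      ((u ⬝ᵥ u' : ℝ) + d * (u ⬝ᵥ v' : ℝ)) / 2 := by
    intro d u u' v'
    simp only [complexify_eq, ← dotProduct_toComplex, dotProduct_smul, dotProduct_add,
      smul_eq_mul]
    ring
  refine ⟨contDiffOn_complexify _ hX hY, contDiffOn_complexify _ hX hY, contDiffOn_toComplex hn,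
    fun w hw ↦ ?_, fun w hw ↦ ?_, fun w hw ↦ ?_, fun w hw ↦ ?_, fun w hw ↦ ?_, fun w hw ↦ ?_,
    fun w hw ↦ ?_, fun w hw ↦ ?_, fun w hw ↦ ?_⟩
  · rw [dot, hXY w hw, dotProduct_comm (Y w) (X w), h0 w hw, Complex.ofReal_zero]
    linear_combination (Y w ⬝ᵥ Y w : ℝ) / 4 * hI
  · rw [dot, hXY w hw, dotProduct_comm (Y w) (X w), h0 w hw, Complex.ofReal_zero]
    linear_combination (Y w ⬝ᵥ Y w : ℝ) / 4 * hI
  · rw [dotProduct_toComplex, hnn w hw]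
    simp
  · rw [dotn, hnX w hw, hnY w hw]
    simp
  · rw [dotn, hnX w hw, hnY w hw]
    simp
  · have hpos := dotProduct_self_pos_of_det (hdet w hw)
    have e : complexify (-I) (X w) (Y w) ⬝ᵥ complexify I (X w) (Y w) =
        ((X w ⬝ᵥ X w / 2 : ℝ) : ℂ) := by
      rw [dot, ← hXY w hw, dotProduct_comm (Y w) (X w), h0 w hw]
      push_cast
      linear_combination -(X w ⬝ᵥ X w : ℝ) / 4 * hI
    rw [e, Complex.ofReal_ne_zero]
    positivity
  · obtain ⟨h1, h2⟩ := cross_eq_of_det_pos (hXY w hw) (h0 w hw) (hnn w hw) (hnX w hw) (hnY w hw)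
      (hdet w hw)
    simp only [complexify_eq, map_smul, map_add, cross_toComplex, h1, h2]
    funext k
    simp [toComplex]
    linear_combination ((Y w k : ℂ) / 2) * hI
  · rw [vderiv_complexify _ _ (hd hX w hw) (hd hY w hw),
      vderiv_complexify _ _ (hd hX w hw) (hd hY w hw)]
    simp only [complexify_eq, nabla_add_smul, nabla_toComplex]
    funext k
    have := congrArg (fun x : ℝ ↦ (x : ℂ)) (congrFun (hsymm w hw) k)
    simp [toComplex] at this ⊢
    linear_combination (-I / 2) * this
  · rw [vderiv_toComplex _ (hd hn w hw), vderiv_toComplex _ (hd hn w hw),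
      complexify_add_nabla, complexify_add_nabla, dot, dot, dot]
    have h1 := congrArg (fun x : ℝ ↦ (x : ℂ)) (hmean w hw)
    simp only [Complex.ofReal_sub, Complex.ofReal_neg, Complex.ofReal_mul,
      Complex.ofReal_ofNat] at h1
    rw [← hXY w hw, dotProduct_comm (Y w) (X w), h0 w hw]
    linear_combination h1 / 2 + (((fderiv ℝ n w I + nabla (Y w) (n w)) ⬝ᵥ Y w : ℝ) / 2 +
      (H * (X w ⬝ᵥ X w : ℝ)) / 2 : ℂ) * hI

end RealFrame

/-- The surface in a local parameter, as a map of vector spaces. -/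
def localMap {M : Type*} [TopologicalSpace M] (f : M → SLTilde)
    (φ : OpenPartialHomeomorph M ℂ) : ℂ → ℝ × ℂ := f ∘ φ.symm

/-- The coordinates of the normal in a local parameter. -/
def localNormal {M : Type*} [TopologicalSpace M] (f : M → SLTilde)
    (N : ∀ p, TangentSpace 𝓘(ℝ, ℝ × ℂ) (f p)) (φ : OpenPartialHomeomorph M ℂ) (w : ℂ) : Fin 3 → ℝ := normalCoords f N (φ.symm w)

lemma hopfCoeff_eq {M : Type*} [TopologicalSpace M] (f : M → SLTilde)
    (N : ∀ p, TangentSpace 𝓘(ℝ, ℝ × ℂ) (f p))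
    (φ : OpenPartialHomeomorph M ℂ) (w : ℂ) : hopfCoeff f N φ w =
      (vderiv (-I) (Z f φ) w + nabla (Z f φ w) (Z f φ w)) ⬝ᵥ toComplex (localNormal f N φ w) := by
  simp only [hopfCoeff, wirtinger_eq_cderiv]
  rfl

/-! ### The surface in a conformal chart. -/

section Chart

variable {M : Type*} [TopologicalSpace M] [ChartedSpace ℂ M]
  {f : M → SLTilde} {N : ∀ p, TangentSpace 𝓘(ℝ, ℝ × ℂ) (f p)}

/-- The linear map underlying `diffCoords`. -/
def diffCoordsLM (f : M → SLTilde) (p : M) : ℂ →ₗ[ℝ] (Fin 3 → ℝ) :=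
  let R : LieAlg →ₗ[ℝ] (Fin 3 → ℝ) := Finsupp.lcoeFun.comp frame.repr.toLinearMap
  let R' : (ℝ × ℂ) →ₗ[ℝ] (Fin 3 → ℝ) := R
  let B : (ℝ × ℂ) →L[ℝ] (ℝ × ℂ) :=
    mfderiv 𝓘(ℝ, ℝ × ℂ) 𝓘(ℝ, ℝ × ℂ) (fun h ↦ (f p)⁻¹ * h) (f p)
  let A : ℂ →L[ℝ] (ℝ × ℂ) := mfderiv 𝓘(ℝ, ℂ) 𝓘(ℝ, ℝ × ℂ) f p
  R'.comp (B.comp A).toLinearMap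

lemma diffCoords_smul (f : M → SLTilde) (p : M) (r : ℝ) (u : TangentSpace 𝓘(ℝ, ℂ) p) :
    diffCoords f p (r • u) = r • diffCoords f p u :=
  map_smul (diffCoordsLM f p) r u

lemma nabla_smul_left (r : ℝ) (u v : Fin 3 → ℝ) : nabla (r • u) v = r • nabla u v := by
  simp only [nabla_eq]
  funext k
  fin_cases k <;> simp <;> ring

lemma covDerivNormal_smul (f : M → SLTilde) (N : ∀ p, TangentSpace 𝓘(ℝ, ℝ × ℂ) (f p)) (p : M)
    (r : ℝ) (u : TangentSpace 𝓘(ℝ, ℂ) p) :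
    covDerivNormal f N p (r • u) = r • covDerivNormal f N p u := by
  funext i
  simp only [covDerivNormal, diffCoords_smul, nabla_smul_left, map_smul, Pi.smul_apply, smul_add]
  rfl

variable {φ : OpenPartialHomeomorph M ℂ}

lemma contDiffOn_localMap [IsManifold 𝓘(ℝ, ℂ) ∞ M] (hf : IsSmoothImmersion f)
    (hφ : φ ∈ IsManifold.maximalAtlas 𝓘(ℝ, ℂ) ∞ M) :
    ContDiffOn ℝ ∞ (localMap f φ) φ.target := by
  rw [← contMDiffOn_iff_contDiffOn]
  exact hf.smooth.comp_contMDiffOn (contMDiffOn_symm_of_mem_maximalAtlas hφ)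

lemma contDiffOn_localNormal [IsManifold 𝓘(ℝ, ℂ) ∞ M] (hN : IsUnitNormalField f N)
    (hφ : φ ∈ IsManifold.maximalAtlas 𝓘(ℝ, ℂ) ∞ M) :
    ContDiffOn ℝ ∞ (localNormal f N φ) φ.target := by
  rw [← contMDiffOn_iff_contDiffOn]
  exact hN.smooth.comp_contMDiffOn (contMDiffOn_symm_of_mem_maximalAtlas hφ)

lemma mdifferentiableAt_symm [IsManifold 𝓘(ℝ, ℂ) ∞ M]
    (hφ : φ ∈ IsManifold.maximalAtlas 𝓘(ℝ, ℂ) ∞ M) {w : ℂ} (hw : w ∈ φ.target) :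
    MDifferentiableAt 𝓘(ℝ, ℂ) 𝓘(ℝ, ℂ) φ.symm w :=
  ((contMDiffOn_symm_of_mem_maximalAtlas hφ).contMDiffAt
    (φ.open_target.mem_nhds hw)).mdifferentiableAt (by simp)

lemma diffCoords_comp_symm [IsManifold 𝓘(ℝ, ℂ) ∞ M] (hf : IsSmoothImmersion f)
    (hφ : φ ∈ IsManifold.maximalAtlas 𝓘(ℝ, ℂ) ∞ M) {w : ℂ} (hw : w ∈ φ.target) (u : ℂ) :
    diffCoords (localMap f φ) w u =
      diffCoords f (φ.symm w) (mfderiv 𝓘(ℝ, ℂ) 𝓘(ℝ, ℂ) φ.symm w u) := by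
  have e : mfderiv 𝓘(ℝ, ℂ) 𝓘(ℝ, ℝ × ℂ) (f ∘ φ.symm) w =
      (mfderiv 𝓘(ℝ, ℂ) 𝓘(ℝ, ℝ × ℂ) f (φ.symm w)).comp (mfderiv 𝓘(ℝ, ℂ) 𝓘(ℝ, ℂ) φ.symm w) :=
    mfderiv_comp w (hf.smooth.mdifferentiableAt (by simp)) (mdifferentiableAt_symm hφ hw)
  change coords (f (φ.symm w)) (mfderiv 𝓘(ℝ, ℂ) 𝓘(ℝ, ℝ × ℂ) (f ∘ φ.symm) w u) =
    coords (f (φ.symm w)) (mfderiv 𝓘(ℝ, ℂ) 𝓘(ℝ, ℝ × ℂ) f (φ.symm w)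
      (mfderiv 𝓘(ℝ, ℂ) 𝓘(ℝ, ℂ) φ.symm w u))
  rw [e]
  rfl

lemma covDerivNormal_comp_symm [IsManifold 𝓘(ℝ, ℂ) ∞ M] (hf : IsSmoothImmersion f)
    (hN : IsUnitNormalField f N)
    (hφ : φ ∈ IsManifold.maximalAtlas 𝓘(ℝ, ℂ) ∞ M) {w : ℂ} (hw : w ∈ φ.target) (u : ℂ) :
    covDerivNormal f N (φ.symm w) (mfderiv 𝓘(ℝ, ℂ) 𝓘(ℝ, ℂ) φ.symm w u) =
      fderiv ℝ (localNormal f N φ) w u +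
        nabla (diffCoords (localMap f φ) w u) (localNormal f N φ w) := by
  have h1 := mfderiv_comp w (hN.smooth.mdifferentiableAt (x := φ.symm w) (by simp))
    (mdifferentiableAt_symm hφ hw)
  have h2 : (mfderiv 𝓘(ℝ, ℂ) 𝓘(ℝ, Fin 3 → ℝ) (normalCoords f N ∘ φ.symm) w : ℂ →L[ℝ] Fin 3 → ℝ) =
    fderiv ℝ (localNormal f N φ) w := mfderiv_eq_fderiv
  rw [diffCoords_comp_symm hf hφ hw, ← h2]
  funext i
  have h3 := congrArg (fun L : ℂ →L[ℝ] (Fin 3 → ℝ) ↦ L u i) h1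
  exact congrArg (fun x : ℝ ↦ x + nabla (diffCoords f (φ.symm w)
    (mfderiv 𝓘(ℝ, ℂ) 𝓘(ℝ, ℂ) φ.symm w u)) (normalCoords f N (φ.symm w)) i) h3.symm

/-- The mean curvature in a conformal parameter. -/
lemma mean_curvature_localMap [IsManifold 𝓘(ℝ, ℂ) ∞ M] (hf : IsSmoothImmersion f)
    (hN : IsUnitNormalField f N) {H : ℝ} (hφ : IsConformalParameter f N φ) {w : ℂ}
    (hw : w ∈ φ.target) (hH : HasMeanCurvatureAt f N H (φ.symm w)) :
    -((fderiv ℝ (localNormal f N φ) w 1 + nabla (partialX f φ w) (localNormal f N φ w)) ⬝ᵥ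
        partialX f φ w) -
      (fderiv ℝ (localNormal f N φ) w I + nabla (partialY f φ w) (localNormal f N φ w)) ⬝ᵥ
        partialY f φ w = 2 * H * (partialX f φ w ⬝ᵥ partialX f φ w) := by
  obtain ⟨h1, h2⟩ := hφ.conformal w hw
  have hpos := dotProduct_self_pos_of_det (hφ.positive w hw)
  set D := mfderiv 𝓘(ℝ, ℂ) 𝓘(ℝ, ℂ) φ.symm w with hD
  have eX : diffCoords f (φ.symm w) (D (1 : ℂ)) = partialX f φ w :=
    (diffCoords_comp_symm hf hφ.mem_maximalAtlas hw 1).symm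
  have eY : diffCoords f (φ.symm w) (D I) = partialY f φ w :=
    (diffCoords_comp_symm hf hφ.mem_maximalAtlas hw I).symm
  have cX : covDerivNormal f N (φ.symm w) (D (1 : ℂ)) = _ :=
    covDerivNormal_comp_symm hf hN hφ.mem_maximalAtlas hw 1
  have cY : covDerivNormal f N (φ.symm w) (D I) = _ :=
    covDerivNormal_comp_symm hf hN hφ.mem_maximalAtlas hw I
  have eX' : diffCoords (localMap f φ) w (1 : ℂ) = partialX f φ w := rfl
  have eY' : diffCoords (localMap f φ) w I = partialY f φ w := rfl
  rw [eX'] at cX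
  rw [eY'] at cY
  rw [← cX, ← cY]
  -- The mean curvature is defined through orthonormal pairs; this factor makes `r f_x`, `r f_y`
  -- such a pair.
  set r := (√(partialX f φ w ⬝ᵥ partialX f φ w))⁻¹ with hr
  have hrr : r * r * (partialX f φ w ⬝ᵥ partialX f φ w) = 1 := by
    have h3 : √(partialX f φ w ⬝ᵥ partialX f φ w) ≠ 0 := (Real.sqrt_pos.2 hpos).ne'
    have h4 := Real.mul_self_sqrt hpos.le
    rw [hr]
    field_simp
    rw [sq, h4]
  have im : ∀ u v, inducedMetric f (φ.symm w) u v =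
    diffCoords f (φ.symm w) u ⬝ᵥ diffCoords f (φ.symm w) v := fun u v ↦ rfl
  have key := hH (r • D (1 : ℂ)) (r • D I)
    (by rw [im, diffCoords_smul, eX, smul_dotProduct, dotProduct_smul, ← hrr]
        simp only [smul_eq_mul]; ring)
    (by rw [im, diffCoords_smul, eY, smul_dotProduct, dotProduct_smul, ← h1, ← hrr]
        simp only [smul_eq_mul]; ring)
    (by rw [im, diffCoords_smul, diffCoords_smul, eX, eY, smul_dotProduct, dotProduct_smul, h2]
        simp)
  simp only [secondFundamentalForm, diffCoords_smul, covDerivNormal_smul, eX, eY,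
    smul_dotProduct, dotProduct_smul, smul_eq_mul] at key
  rw [key]
  set P := covDerivNormal f N (φ.symm w) (D (1 : ℂ)) ⬝ᵥ partialX f φ w
  set Q := covDerivNormal f N (φ.symm w) (D I) ⬝ᵥ partialY f φ w
  linear_combination (P + Q) * hrr

lemma normal_orthogonal [IsManifold 𝓘(ℝ, ℂ) ∞ M] (hf : IsSmoothImmersion f)
    (hN : IsUnitNormalField f N) (hφ : φ ∈ IsManifold.maximalAtlas 𝓘(ℝ, ℂ) ∞ M) {w : ℂ}
    (hw : w ∈ φ.target) (u : ℂ) :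
    localNormal f N φ w ⬝ᵥ diffCoords (localMap f φ) w u = 0 := by
  rw [diffCoords_comp_symm hf hφ hw]
  exact hN.orthogonal (φ.symm w) _

lemma isCMCFrame_localMap [IsManifold 𝓘(ℝ, ℂ) ∞ M] (hf : IsSmoothImmersion f)
    (hN : IsUnitNormalField f N) {H : ℝ} (hH : ∀ p, HasMeanCurvatureAt f N H p)
    (hφ : IsConformalParameter f N φ) :
    IsCMCFrame φ.target (Z f φ) (fun w ↦ complexify I (partialX f φ w) (partialY f φ w))
      (fun w ↦ toComplex (localNormal f N φ w)) H := by
  have hF := contDiffOn_localMap hf hφ.mem_maximalAtlas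
  have hZ : Z f φ = fun w ↦ complexify (-I) (partialX f φ w) (partialY f φ w) := by
    funext w k
    rw [Z, complexify]
    ring
  rw [hZ]
  exact isCMCFrame_of_real φ.open_target (contDiffOn_diffCoords φ.open_target hF 1)
    (contDiffOn_diffCoords φ.open_target hF I) (contDiffOn_localNormal hN hφ.mem_maximalAtlas)
    (fun w hw ↦ (hφ.conformal w hw).1) (fun w hw ↦ (hφ.conformal w hw).2)
    (fun w hw ↦ hN.unit (φ.symm w))
    (fun w hw ↦ normal_orthogonal hf hN hφ.mem_maximalAtlas hw 1)
    (fun w hw ↦ normal_orthogonal hf hN hφ.mem_maximalAtlas hw I) hφ.positive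
    (fun w hw ↦ diffCoords_symm φ.open_target hF hw 1 I)
    (fun w hw ↦ mean_curvature_localMap hf hN hφ hw (hH _))

lemma ofReal_sub_I_ne_zero (H : ℝ) : (H : ℂ) - I ≠ 0 := fun h ↦ by
  simpa using congrArg Complex.im h

lemma differentiableOn_abreschCoeff [IsManifold 𝓘(ℝ, ℂ) ∞ M] (hf : IsSmoothImmersion f)
    (hN : IsUnitNormalField f N) {H : ℝ} (hH : ∀ p, HasMeanCurvatureAt f N H p)
    (hφ : IsConformalParameter f N φ) : DifferentiableOn ℂ (abreschCoeff f N H φ) φ.target :=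
  ((isCMCFrame_localMap hf hN hH hφ).differentiableOn φ.open_target
    (ofReal_sub_I_ne_zero H)).congr fun w _ ↦ by rw [abreschCoeff, hopfCoeff_eq]

end Chart

/-! ### Change of conformal parameters. -/

section Transformation

/-- The coefficients `p, q, r, s` form the Jacobian of the parameter change. It maps one conformal
pair to another and has positive determinant, both pairs being positive with respect to the same
`n`; hence it is a rotation times a dilation. -/
lemma cauchyRiemann_of_conformal {X Y X' Y' n : Fin 3 → ℝ} {p q r s : ℝ}
    (hX : X = p • X' + q • Y') (hY : Y = r • X' + s • Y')
    (hXY : X ⬝ᵥ X = Y ⬝ᵥ Y) (h0 : X ⬝ᵥ Y = 0) (hXY' : X' ⬝ᵥ X' = Y' ⬝ᵥ Y') (h0' : X' ⬝ᵥ Y' = 0)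
    (hd : 0 < (Matrix.of ![X, Y, n]).det) (hd' : 0 < (Matrix.of ![X', Y', n]).det) :
    r = -q ∧ s = p := by
  have hpos := dotProduct_self_pos_of_det hd'
  have ed : (Matrix.of ![X, Y, n]).det = (p * s - q * r) * (Matrix.of ![X', Y', n]).det := by
    rw [hX, hY, Matrix.det_fin_three, Matrix.det_fin_three]
    simp
    ring
  rw [ed] at hd
  have hD : 0 < p * s - q * r := (mul_pos_iff_of_pos_right hd').1 hd
  simp only [hX, hY, add_dotProduct, dotProduct_add, smul_dotProduct, dotProduct_smul, smul_eq_mul,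
    dotProduct_comm Y' X', h0', ← hXY'] at hXY h0
  have e1 : p * p + q * q = r * r + s * s :=
    mul_right_cancel₀ hpos.ne' (by linear_combination hXY)
  have e2 : p * r + q * s = 0 := mul_right_cancel₀ hpos.ne' (by linear_combination h0)
  -- Lagrange's identity `(ps - qr)² + (pr + qs)² = (p² + q²)(r² + s²)`, with the sign of the root
  -- fixed by `hD`.
  have e3 : p * s - q * r = p * p + q * q := by
    refine (sq_eq_sq₀ hD.le (by nlinarith [mul_self_nonneg p, mul_self_nonneg q])).1 ?_
    linear_combination -(p * p + q * q) * e1 - (p * r + q * s) * e2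
  have e4 : (p - s) ^ 2 + (q + r) ^ 2 = 0 := by linear_combination -2 * e3 - e1
  have e5 : p - s = 0 := by nlinarith [sq_nonneg (p - s), sq_nonneg (q + r)]
  have e6 : q + r = 0 := by nlinarith [sq_nonneg (p - s), sq_nonneg (q + r)]
  exact ⟨by linarith, by linarith⟩

variable {F G : ℂ → ℝ × ℂ} {T : ℂ → ℂ} {w : ℂ}

lemma fderiv_comp_of_eventuallyEq {E : Type*} [NormedAddCommGroup E] [NormedSpace ℝ E]
    {F G : ℂ → E} (hG : DifferentiableAt ℝ G (T w)) (hT : DifferentiableAt ℝ T w)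
    (h : F =ᶠ[nhds w] fun ζ ↦ G (T ζ)) (u : ℂ) :
    fderiv ℝ F w u = (fderiv ℝ T w u).re • fderiv ℝ G (T w) 1 +
      (fderiv ℝ T w u).im • fderiv ℝ G (T w) I := by
  rw [h.fderiv_eq, fderiv_fun_comp w hG hT, ContinuousLinearMap.comp_apply, ← map_smul, ← map_smul,
    ← map_add]
  congr 1
  apply Complex.ext <;> simp

lemma diffCoords_comp (hG : DifferentiableAt ℝ G (T w)) (hT : DifferentiableAt ℝ T w)
    (h : F =ᶠ[nhds w] fun ζ ↦ G (T ζ)) (u : ℂ) :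
    diffCoords F w u = (fderiv ℝ T w u).re • diffCoords G (T w) (1 : ℂ) +
      (fderiv ℝ T w u).im • diffCoords G (T w) I := by
  have e : ∀ (F : ℂ → ℝ × ℂ) (w u : ℂ), diffCoords F w u = coords (F w) (fderiv ℝ F w u) :=
    fun F w u ↦ congrArg (fun L : ℂ →L[ℝ] (ℝ × ℂ) ↦ coords (F w) (L u)) mfderiv_eq_fderiv
  have h2 : DifferentiableAt ℝ F w :=
    (DifferentiableAt.comp w hG hT).congr_of_eventuallyEq h
  rw [diffCoords_eq h2, diffCoords_eq hG, diffCoords_eq hG, h.eq_of_nhds]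
  have ha : (fun ζ ↦ a (F ζ)) =ᶠ[nhds w] fun ζ ↦ a (G (T ζ)) := h.mono fun ζ hζ ↦ by
    simp only [hζ]
  have hb : (fun ζ ↦ b (F ζ)) =ᶠ[nhds w] fun ζ ↦ b (G (T ζ)) := h.mono fun ζ hζ ↦ by
    simp only [hζ]
  have da : DifferentiableAt ℝ (fun ζ ↦ a (G ζ)) (T w) :=
    DifferentiableAt.comp (T w) (differentiable_a _) hG
  have db : DifferentiableAt ℝ (fun ζ ↦ b (G ζ)) (T w) :=
    DifferentiableAt.comp (g := fun h : ℝ × ℂ ↦ h.2) (T w) differentiableAt_snd hG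
  rw [fderiv_comp_of_eventuallyEq da hT ha, fderiv_comp_of_eventuallyEq db hT hb]
  funext k
  fin_cases k <;> simp [frameCoords] <;> ring

/-- The chain rule for `∂` under a holomorphic change of parameter: the real Jacobian of
multiplication by `c` acts on `u - i v` as `c`. -/
lemma complexify_rotate {c : ℂ} (u v : Fin 3 → ℝ) :
    complexify (-I) (c.re • u + c.im • v) (-c.im • u + c.re • v) = c • complexify (-I) u v := by
  funext k
  have hc : (c.re : ℂ) + c.im * I = c := Complex.re_add_im c
  simp [complexify]
  linear_combination ((u k - I * v k) / 2 : ℂ) * hc + (c.im * v k / 2 : ℂ) * Complex.I_mul_I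

lemma eventually_symm_eq {M : Type*} [TopologicalSpace M]
    {φ ψ : OpenPartialHomeomorph M ℂ} {p : M} (hp : p ∈ φ.source ∩ ψ.source) :
    ∀ᶠ ζ in nhds (φ p), φ.symm ζ = ψ.symm ((ψ ∘ φ.symm) ζ) := by
  have h1 : Filter.Tendsto φ.symm (nhds (φ p)) (nhds p) := by
    have := φ.symm.continuousAt (x := φ p) (φ.map_source hp.1)
    rwa [ContinuousAt, φ.left_inv hp.1] at this
  filter_upwards [h1.eventually (ψ.open_source.mem_nhds hp.2)] with ζ hζ
  exact (ψ.left_inv hζ).symm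

variable {M : Type*} [TopologicalSpace M] [ChartedSpace ℂ M] [IsManifold 𝓘(ℝ, ℂ) ∞ M]
  {f : M → SLTilde} {N : ∀ p, TangentSpace 𝓘(ℝ, ℝ × ℂ) (f p)}
  {φ ψ : OpenPartialHomeomorph M ℂ}

lemma differentiableAt_transition (hφ : φ ∈ IsManifold.maximalAtlas 𝓘(ℝ, ℂ) ∞ M)
    (hψ : ψ ∈ IsManifold.maximalAtlas 𝓘(ℝ, ℂ) ∞ M) {p : M} (hp : p ∈ φ.source ∩ ψ.source) :
    DifferentiableAt ℝ (ψ ∘ φ.symm) (φ p) := by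
  rw [← mdifferentiableAt_iff_differentiableAt]
  have h1 := mdifferentiableAt_symm hφ (φ.map_source hp.1)
  have h2 : MDifferentiableAt 𝓘(ℝ, ℂ) 𝓘(ℝ, ℂ) ψ (φ.symm (φ p)) := by
    rw [φ.left_inv hp.1]
    exact (contMDiffAt_of_mem_maximalAtlas hψ hp.2).mdifferentiableAt (by simp)
  exact h2.comp (φ p) h1

/-- In this form no second derivative of the surface occurs, so that only first-order chain rules
are needed for the transformation law. -/
lemma hopfCoeff_eq_complexify (hf : IsSmoothImmersion f) (hN : IsUnitNormalField f N) {H : ℝ}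
    (hH : ∀ p, HasMeanCurvatureAt f N H p) (hφ : IsConformalParameter f N φ) {w : ℂ}
    (hw : w ∈ φ.target) : hopfCoeff f N φ w = -(complexify (-I)
      (fderiv ℝ (localNormal f N φ) w 1 + nabla (partialX f φ w) (localNormal f N φ w))
      (fderiv ℝ (localNormal f N φ) w I + nabla (partialY f φ w) (localNormal f N φ w)) ⬝ᵥ
        complexify (-I) (partialX f φ w) (partialY f φ w)) := by
  have hZ : Z f φ w = complexify (-I) (partialX f φ w) (partialY f φ w) := by
    funext k
    rw [Z, complexify]
    ring
  rw [hopfCoeff_eq, (isCMCFrame_localMap hf hN hH hφ).hopf_eq φ.open_target w hw, hZ,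
    vderiv_toComplex, complexify_add_nabla]
  exact ((contDiffOn_localNormal hN hφ.mem_maximalAtlas).differentiableOn
    (by simp)).differentiableAt (φ.open_target.mem_nhds hw)

/-- The Hopf coefficient is bilinear in two factors, `∇_∂ n` and `Z`, each of which acquires one
factor `c`; the normal itself is unchanged. -/
lemma abreschCoeff_transform (hf : IsSmoothImmersion f) (hN : IsUnitNormalField f N) {H : ℝ}
    (hH : ∀ p, HasMeanCurvatureAt f N H p) (hφ : IsConformalParameter f N φ)
    (hψ : IsConformalParameter f N ψ) {p : M} (hp : p ∈ φ.source ∩ ψ.source) :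
    ∃ c : ℂ, HasDerivAt (ψ ∘ φ.symm) c (φ p) ∧
      abreschCoeff f N H φ (φ p) = abreschCoeff f N H ψ (ψ p) * c ^ 2 := by
  have hT := differentiableAt_transition hφ.mem_maximalAtlas hψ.mem_maximalAtlas hp
  have hev := eventually_symm_eq hp
  have hTp : (ψ ∘ φ.symm) (φ p) = ψ p := by simp [φ.left_inv hp.1]
  have hφt := φ.map_source hp.1
  have hψt := ψ.map_source hp.2
  have hG : DifferentiableAt ℝ (localMap f ψ) (ψ p) :=
    ((contDiffOn_localMap hf hψ.mem_maximalAtlas).differentiableOn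
      (by simp)).differentiableAt (ψ.open_target.mem_nhds hψt)
  have hn : DifferentiableAt ℝ (localNormal f N ψ) (ψ p) :=
    ((contDiffOn_localNormal hN hψ.mem_maximalAtlas).differentiableOn
      (by simp)).differentiableAt (ψ.open_target.mem_nhds hψt)
  rw [← hTp] at hG hn
  have hF : localMap f φ =ᶠ[nhds (φ p)] fun ζ ↦ localMap f ψ ((ψ ∘ φ.symm) ζ) :=
    hev.mono fun ζ hζ ↦ congrArg f hζ
  have hnn : localNormal f N φ =ᶠ[nhds (φ p)] fun ζ ↦ localNormal f N ψ ((ψ ∘ φ.symm) ζ) :=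
    hev.mono fun ζ hζ ↦ congrArg (normalCoords f N) hζ
  have dF := diffCoords_comp hG hT hF
  have dn := fderiv_comp_of_eventuallyEq hn hT hnn
  have n0 : localNormal f N φ (φ p) = localNormal f N ψ (ψ p) := by
    rw [← hTp]
    exact hnn.eq_of_nhds
  rw [hTp] at dF dn
  have eX : partialX f φ (φ p) = _ := dF 1
  have eY : partialY f φ (φ p) = _ := dF I
  change _ = _ • partialX f ψ (ψ p) + _ • partialY f ψ (ψ p) at eX eY
  have dφ := hφ.positive (φ p) hφt
  have dψ := hψ.positive (ψ p) hψt
  have n0' : normalCoords f N (φ.symm (φ p)) = normalCoords f N (ψ.symm (ψ p)) := n0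
  rw [n0'] at dφ
  obtain ⟨hr, hs⟩ := cauchyRiemann_of_conformal eX eY (hφ.conformal _ hφt).1
    (hφ.conformal _ hφt).2 (hψ.conformal _ hψt).1 (hψ.conformal _ hψt).2 dφ dψ
  have dn1 := dn 1
  have dnI := dn I
  set c := fderiv ℝ (ψ ∘ φ.symm) (φ p) 1 with hc
  have hCR : fderiv ℝ (ψ ∘ φ.symm) (φ p) I = I • c := by
    apply Complex.ext <;> simp [hr, hs]
  rw [hr, hs] at eY dnI
  refine ⟨c, complexOfReal_hasDerivAt hT hCR, ?_⟩
  have hZ : ∀ (φ : OpenPartialHomeomorph M ℂ) w,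
      Z f φ w = complexify (-I) (partialX f φ w) (partialY f φ w) := fun φ w ↦ by
    funext k
    rw [Z, complexify]
    ring
  have hZc : complexify (-I) (partialX f φ (φ p)) (partialY f φ (φ p)) =
      c • complexify (-I) (partialX f ψ (ψ p)) (partialY f ψ (ψ p)) := by
    rw [eX, eY, complexify_rotate]
  have hnc : complexify (-I) (fderiv ℝ (localNormal f N φ) (φ p) 1)
      (fderiv ℝ (localNormal f N φ) (φ p) I) = c • complexify (-I)
        (fderiv ℝ (localNormal f N ψ) (ψ p) 1) (fderiv ℝ (localNormal f N ψ) (ψ p) I) := by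
    rw [dn1, dnI, complexify_rotate]
  rw [abreschCoeff, abreschCoeff, hopfCoeff_eq_complexify hf hN hH hφ hφt,
    hopfCoeff_eq_complexify hf hN hH hψ hψt, hZ, hZ, ← complexify_add_nabla,
    ← complexify_add_nabla, hZc, hnc, n0]
  have hl : ∀ u v : Fin 3 → ℂ, nabla (c • u) v = c • nabla u v := fun u v ↦ by
    have := nabla_add_smul u 0 v 0 c 1 0 0
    simpa using this
  rw [hl, ← smul_add, smul_dotProduct, dotProduct_smul]
  simp only [smul_eq_mul, Pi.smul_apply]
  ring

end Transformation

end SLTilde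

end

theorem mainTheorem5 {M : Type*} [TopologicalSpace M] [ChartedSpace ℂ M]
    [IsManifold 𝓘(ℝ, ℂ) ∞ M] (f : M → SLTilde) (hf : SLTilde.IsSmoothImmersion f)
    (N : ∀ p, TangentSpace 𝓘(ℝ, ℝ × ℂ) (f p)) (hN : SLTilde.IsUnitNormalField f N)
    (H : ℝ) (hH : ∀ p, SLTilde.HasMeanCurvatureAt f N H p) :
    SLTilde.IsHolomorphicQuadraticDifferential
      {φ | SLTilde.IsConformalParameter f N φ} (SLTilde.abreschCoeff f N H) where
  transform _ hφ _ hψ _ hp := SLTilde.abreschCoeff_transform hf hN hH hφ hψ hp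
  holomorphic _ hφ := SLTilde.differentiableOn_abreschCoeff hf hN hH hφ
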